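/- Let $L>0$, let $a,b,c>0$, and let $p\in L^1[0,L]$. Consider the Melan problem $$w''''(x)-\Big(a+b\int_0^L w\Big)w''(x)+c\int_0^L w=p(x)\ \text{ for a.e. } x\in(0,L),\qquad w(0)=w(L)=w''(0)=w''(L)=0,\tag{P}$$ whose solutions are sought in $W^{4,1}[0,L]$. A function $\alpha\in W^{4,1}[0,L]$ satisfying the boundary conditions of (P) is a lower solution if $$\alpha''''-\Big(a+b\int_0^L\alpha\Big)\alpha''+c\int_0^L\alpha\le p\quad\text{a.e. on }(0,L);$$ an upper solution $\beta$ is defined with the reverse inequality. For $t>0$ put $$\sigma(t)=\frac{3t^3}{6t\cosh t+6t-12\sinh t-t^3}.$$ **Theorem 4.1.** Let $M,N>0$ with $N\le \frac{4M}{L^3}\,\sigma(\sqrt M\,L)$. Suppose that (P) has a lower solution $\alpha$ and an upper solution $\beta$ such that $$0\le\alpha\le\beta,\qquad 0\ge\alpha''\ge\beta''\qquad\text{on }[0,L],$$ $$a+b\int_0^L\beta\le M,\qquad c-b\min_{[0,L]}\beta''\le N.$$ Then (P) has at least one solution in the sector $$[\alpha,\beta]=\{u\in C^2[0,L]:\ \alpha\le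 u\le\beta,\ \alpha''\ge u''\ge\beta''\text{ on }[0,L]\}.$$ Moreover, consider the iteration which, given $y_{n-1}$, determines $y_n\in W^{4,1}[0,L]$ as the solution of the linear problem $$y_n''''-My_n''+N\int_0^L y_n=p+ay_{n-1}''+b\,y_{n-1}''\int_0^L y_{n-1}-c\int_0^L y_{n-1}-My_{n-1}''+N\int_0^L y_{n-1}\quad\text{a.e. on }(0,L),$$ $$y_n(0)=y_n(L)=y_n''(0)=y_n''(L)=0,\qquad n=1,2,\dots$$ Started at $y_0=\alpha$ and at $y_0=\beta$, it determines unique sequences $(\alpha_n)$ and $(\beta_n)$ on $[0,L]$, with $\alpha_0=\alpha$ and $\beta_0=\beta$. On $[0,L]$ and for all $n\ge0$ they satisfy $$\alpha_n\le\alpha_{n+1},\quad \alpha_n\le\beta_n,\quad \beta_{n+1}\le\beta_n,\qquad \alpha_n''\ge\alpha_{n+1}'',\quad \alpha_n''\ge\beta_n'',\quad \beta_{n+1}''\ge\beta_n''.$$ They converge uniformly on $[0,L]$ to solutions $\underline y$ and $\overline y$ of (P) in $[\alpha,\beta]$, respectively. These are the minimal and the maximal solution of (P) in $[\alpha,\beta]$: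 every solution $y\in[\alpha,\beta]$ of (P) satisfies $\underline y\le y\le\overline y$ and $\underline y''\ge y''\ge\overline y''$ on $[0,L]$. -/

import Mathlib

open Set Filter Topology MeasureTheory

noncomputable section

namespace Melan

/-- The `k`-th derivative of `u` on the closed interval `[0, L]` (one-sided at the endpoints). -/
def D (L : ℝ) (k : ℕ) (u : ℝ → ℝ) : ℝ → ℝ :=
  iteratedDerivWithin k u (Icc 0 L)

/-- The Sobolev space `W^{4,1}[0, L]`, through continuous representatives: `u` is `C³` on
`[0, L]` and `u'''` is absolutely continuous there. The fourth derivative `D L 4 u` then exists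
almost everywhere on `[0, L]`, is integrable, and is the weak fourth derivative of `u`. -/
def MemW41 (L : ℝ) (u : ℝ → ℝ) : Prop :=
  ContDiffOn ℝ 3 u (Icc 0 L) ∧ AbsolutelyContinuousOnInterval (D L 3 u) 0 L

/-- Hinged (Navier) boundary conditions `u(0) = u(L) = u''(0) = u''(L) = 0`. -/
def Hinged (L : ℝ) (u : ℝ → ℝ) : Prop :=
  u 0 = 0 ∧ u L = 0 ∧ D L 2 u 0 = 0 ∧ D L 2 u L = 0

/-- Left-hand side `u'''' - (a + b ∫ u) u'' + c ∫ u` of the Melan equation. -/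
def melanLHS (L a b c : ℝ) (u : ℝ → ℝ) (x : ℝ) : ℝ :=
  D L 4 u x - (a + b * ∫ t in (0 : ℝ)..L, u t) * D L 2 u x + c * ∫ t in (0 : ℝ)..L, u t

/-- Solution in `W^{4,1}[0, L]` of the Melan problem with hinged ends. -/
def IsSolution (L a b c : ℝ) (p u : ℝ → ℝ) : Prop :=
  MemW41 L u ∧ Hinged L u ∧ ∀ᵐ x, x ∈ Ioo 0 L → melanLHS L a b c u x = p x

/-- Lower solution of the Melan problem with hinged ends. -/
def IsLowerSolution (L a b c : ℝ) (p u : ℝ → ℝ) : Prop :=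
  MemW41 L u ∧ Hinged L u ∧ ∀ᵐ x, x ∈ Ioo 0 L → melanLHS L a b c u x ≤ p x

/-- Upper solution of the Melan problem with hinged ends. -/
def IsUpperSolution (L a b c : ℝ) (p u : ℝ → ℝ) : Prop :=
  MemW41 L u ∧ Hinged L u ∧ ∀ᵐ x, x ∈ Ioo 0 L → p x ≤ melanLHS L a b c u x

/-- `u ≤ v` and `u'' ≥ v''` on `[0, L]`. -/
def Precedes (L : ℝ) (u v : ℝ → ℝ) : Prop :=
  ∀ x ∈ Icc 0 L, u x ≤ v x ∧ D L 2 v x ≤ D L 2 u x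

/-- The sector `[α, β]`: the `u` in `C²[0, L]` with `α ≤ u ≤ β` and `α'' ≥ u'' ≥ β''`. -/
def sector (L : ℝ) (α β : ℝ → ℝ) : Set (ℝ → ℝ) :=
  {u | ContDiffOn ℝ 2 u (Icc 0 L) ∧ Precedes L α u ∧ Precedes L u β}

/-- `σ(t) = 3 t³ / (6 t cosh t + 6 t - 12 sinh t - t³)`. -/
def σ (t : ℝ) : ℝ :=
  3 * t ^ 3 / (6 * t * Real.cosh t + 6 * t - 12 * Real.sinh t - t ^ 3)

/-- The linear integro-differential operator `G w = w'''' - M w'' + N ∫ w`. -/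
def G (L M N : ℝ) (w : ℝ → ℝ) (x : ℝ) : ℝ :=
  D L 4 w x - M * D L 2 w x + N * ∫ t in (0 : ℝ)..L, w t

/-- The nonlinearity `f(x, I, z) = p(x) + a z + b z I - c I`. -/
def f (a b c : ℝ) (p : ℝ → ℝ) (x I z : ℝ) : ℝ :=
  p x + a * z + b * z * I - c * I

/-- One step of the iteration: `v` in `W^{4,1}[0, L]`, with hinged ends, solves the linear problem
`G v = f(x, ∫ u, u'') - M u'' + N ∫ u`. -/
def IsStep (L a b c M N : ℝ) (p u v : ℝ → ℝ) : Prop :=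
  MemW41 L v ∧ Hinged L v ∧ ∀ᵐ x, x ∈ Ioo 0 L →
    G L M N v x = f a b c p x (∫ t in (0 : ℝ)..L, u t) (D L 2 u x) - M * D L 2 u x
      + N * ∫ t in (0 : ℝ)..L, u t

/-- `y` is an iteration sequence started at `y₀`. -/
def IsIteration (L a b c M N : ℝ) (p y₀ : ℝ → ℝ) (y : ℕ → ℝ → ℝ) : Prop :=
  y 0 = y₀ ∧ ∀ n, IsStep L a b c M N p (y n) (y (n + 1))

end Melan

end

/-! ### Calculus in `W^{4,1}[0, L]` -/

namespace Melan

/-! The proof is monotone iteration for the order `Precedes`, which compares functions and,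
reversed, their second derivatives. Put `m = √M`. The engine is inverse positivity of `G w = w'''' -
m² w'' + N ∫ w` with hinged ends (`inverse_positivity`).

The nonlocal term is absorbed by the solution `ψ` of `ψ'''' - m² ψ'' = 1` (`unitLoad`): `v = w + N
(∫ w) ψ` satisfies `v'''' - m² v'' = G w` and `∫ v = (1 + N ∫ ψ) ∫ w`. With `e = -ψ''` (`torsion`),
the claim `w'' ≤ 0` says that `-v''` dominates `N e ∫ w`. `torsion_mul_integral_le` gives the
quantitative form `e ∫ v ≤ C (-v'')`: Green's formula expresses `-v''` through `sinh` kernels, `∫ v`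
is the integral of `ψ` against `v'''' - m² v''`, and `ψ` and `e` lie below multiples of the same
kernels. What remains is `N C ≤ 1 + N ∫ ψ` (`Admissible`), which follows from the bound on `N` by
`σ`. Concavity then gives `w ≥ 0`.

The bounds on `β` make the right-hand side of the iteration monotone below `β` (`IsStep.precedes`),
so the iterates are ordered. Their second derivatives are pointwise monotone and bounded, and
dominated convergence with an `L¹` to sup bound for the linear problem gives uniform limits that
solve the equation (`IsIteration.exists_limit`). A solution is a fixed point of the step, so
induction traps each solution in the sector between the two iterations. -/

theorem AbsolutelyContinuousOnInterval.congr_of_eqOn {f g : ℝ → ℝ} {a b : ℝ}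
    (hf : AbsolutelyContinuousOnInterval f a b) (h : EqOn f g (uIcc a b)) :
    AbsolutelyContinuousOnInterval g a b := by
  rw [absolutelyContinuousOnInterval_iff] at hf ⊢
  intro ε hε
  obtain ⟨δ, hδ, H⟩ := hf ε hε
  refine ⟨δ, hδ, fun E hE hlt => ?_⟩
  have := H E hE hlt
  rwa [Finset.sum_congr rfl (g := fun i => dist (g (E.2 i).1) (g (E.2 i).2))] at this
  intro i hi
  obtain ⟨h1, h2⟩ := hE.1 i hi
  rw [h h1, h h2]

/-- Fundamental theorem of calculus for an absolutely continuous function with an a.e.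
derivative. -/
theorem integral_eq_sub_of_ae_hasDerivAt {F F' : ℝ → ℝ} {x y : ℝ} (hxy : x ≤ y)
    (hF : AbsolutelyContinuousOnInterval F x y)
    (h : ∀ᵐ s, s ∈ Ioo x y → HasDerivAt F (F' s) s) :
    IntervalIntegrable F' volume x y ∧ ∫ s in x..y, F' s = F y - F x := by
  have hne : ∀ᵐ s : ℝ, s ≠ y := by simp [ae_iff, measure_singleton]
  have hae : ∀ᵐ s, s ∈ uIoc x y → deriv F s = F' s := by
    filter_upwards [h, hne] with s hs hy hmem
    rw [uIoc_of_le hxy] at hmem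
    exact (hs ⟨hmem.1, lt_of_le_of_ne hmem.2 hy⟩).deriv
  refine ⟨hF.intervalIntegrable_deriv.congr_ae ?_, ?_⟩
  · rwa [EventuallyEq, ae_restrict_iff' measurableSet_uIoc]
  · rw [← intervalIntegral.integral_congr_ae hae, hF.integral_deriv_eq_sub]

/-- A continuous derivative makes the function `C¹` on a compact interval, hence absolutely
continuous. -/
theorem absolutelyContinuousOnInterval_of_hasDerivWithinAt {F F' : ℝ → ℝ} {L : ℝ} (hL : 0 < L)
    (h : ∀ x ∈ Icc 0 L, HasDerivWithinAt F (F' x) (Icc 0 L) x) (hc : ContinuousOn F' (Icc 0 L)) :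
    AbsolutelyContinuousOnInterval F 0 L := by
  apply ContDiffOn.absolutelyContinuousOnInterval
  rw [uIcc_of_le hL.le]
  have hu := uniqueDiffOn_Icc hL
  have := contDiffOn_nat_iff_continuousOn_differentiableOn_deriv (𝕜 := ℝ) (f := F) (n := 1) hu
  refine this.2 ⟨fun k hk => ?_, fun k hk => ?_⟩
  · interval_cases k
    · rw [iteratedDerivWithin_zero]; exact fun x hx => (h x hx).continuousWithinAt
    · rw [iteratedDerivWithin_one]
      exact hc.congr fun x hx => (h x hx).derivWithin (hu x hx)
  · interval_cases k
    rw [iteratedDerivWithin_zero]; exact fun x hx => (h x hx).differentiableWithinAt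

variable {L : ℝ} {u v : ℝ → ℝ}

@[simp] theorem D_zero (L : ℝ) (u : ℝ → ℝ) : D L 0 u = u := iteratedDerivWithin_zero

theorem D_succ (L : ℝ) (k : ℕ) (u : ℝ → ℝ) : D L (k + 1) u = derivWithin (D L k u) (Icc 0 L) :=
  iteratedDerivWithin_succ

theorem D_congr (h : EqOn u v (Icc 0 L)) (k : ℕ) : EqOn (D L k u) (D L k v) (Icc 0 L) :=
  fun _ hx => iteratedDerivWithin_congr h hx

theorem MemW41.hasDerivWithinAt (hL : 0 < L) (hu : MemW41 L u) {k : ℕ} (hk : k < 3) {x : ℝ}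
    (hx : x ∈ Icc 0 L) : HasDerivWithinAt (D L k u) (D L (k + 1) u x) (Icc 0 L) x := by
  rw [D_succ]
  exact (hu.1.differentiableOn_iteratedDerivWithin (m := k) (by exact_mod_cast hk)
    (uniqueDiffOn_Icc hL) x hx).hasDerivWithinAt

theorem MemW41.continuousOn (hL : 0 < L) (hu : MemW41 L u) {k : ℕ} (hk : k ≤ 3) :
    ContinuousOn (D L k u) (Icc 0 L) :=
  hu.1.continuousOn_iteratedDerivWithin (by exact_mod_cast hk) (uniqueDiffOn_Icc hL)

theorem MemW41.hasDerivAt (hL : 0 < L) (hu : MemW41 L u) {k : ℕ} (hk : k < 3) {x : ℝ}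
    (hx : x ∈ Ioo 0 L) : HasDerivAt (D L k u) (D L (k + 1) u x) x :=
  (hu.hasDerivWithinAt hL hk (Ioo_subset_Icc_self hx)).hasDerivAt (Icc_mem_nhds hx.1 hx.2)

theorem MemW41.absolutelyContinuous (hL : 0 < L) (hu : MemW41 L u) {k : ℕ} (hk : k ≤ 3) :
    AbsolutelyContinuousOnInterval (D L k u) 0 L := by
  rcases hk.lt_or_eq with hk | rfl
  · exact absolutelyContinuousOnInterval_of_hasDerivWithinAt hL
      (fun x hx => hu.hasDerivWithinAt hL hk hx) (hu.continuousOn hL hk)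
  · exact hu.2

/-- At interior points the within-derivative is the ordinary one, so `D L 4` can be computed from
any honest derivative of `D L 3`. -/
theorem D_four_eq_of_hasDerivAt {x d : ℝ} (hx : x ∈ Ioo 0 L) (h : HasDerivAt (D L 3 u) d x) :
    D L 4 u x = d := by
  rw [D_succ, derivWithin_of_mem_nhds (Icc_mem_nhds hx.1 hx.2), h.deriv]

/-- Absolutely continuous functions are differentiable almost everywhere. -/
theorem MemW41.ae_hasDerivAt (hL : 0 < L) (hu : MemW41 L u) :
    ∀ᵐ x, x ∈ Ioo 0 L → HasDerivAt (D L 3 u) (D L 4 u x) x := by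
  filter_upwards [hu.2.ae_differentiableAt] with x hx hmem
  have h := (hx (by rw [uIcc_of_le hL.le]; exact Ioo_subset_Icc_self hmem)).hasDerivAt
  rwa [D_four_eq_of_hasDerivAt hmem h]

theorem MemW41.intervalIntegrable_D_four (hL : 0 < L) (hu : MemW41 L u) :
    IntervalIntegrable (D L 4 u) volume 0 L :=
  (integral_eq_sub_of_ae_hasDerivAt hL.le hu.2 (hu.ae_hasDerivAt hL)).1

theorem MemW41.intervalIntegrable (hL : 0 < L) (hu : MemW41 L u) {k : ℕ} (hk : k ≤ 3) :
    IntervalIntegrable (D L k u) volume 0 L := by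
  apply ContinuousOn.intervalIntegrable
  rw [uIcc_of_le hL.le]
  exact hu.continuousOn hL hk

theorem D_succ_eqOn_of_hasDerivWithinAt (hL : 0 < L) {k : ℕ} {w w' : ℝ → ℝ}
    (hk : EqOn (D L k u) w (Icc 0 L))
    (h : ∀ x ∈ Icc 0 L, HasDerivWithinAt w (w' x) (Icc 0 L) x) :
    EqOn (D L (k + 1) u) w' (Icc 0 L) := by
  intro x hx
  rw [D_succ, derivWithin_congr hk (hk hx)]
  exact (h x hx).derivWithin (uniqueDiffOn_Icc hL x hx)

/-- Membership in `W^{4,1}[0, L]` from an explicit chain of derivatives. -/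
theorem memW41_of_hasDerivWithinAt (hL : 0 < L) {w₀ w₁ w₂ w₃ : ℝ → ℝ}
    (h₀ : ∀ x ∈ Icc 0 L, HasDerivWithinAt w₀ (w₁ x) (Icc 0 L) x)
    (h₁ : ∀ x ∈ Icc 0 L, HasDerivWithinAt w₁ (w₂ x) (Icc 0 L) x)
    (h₂ : ∀ x ∈ Icc 0 L, HasDerivWithinAt w₂ (w₃ x) (Icc 0 L) x)
    (h₃ : AbsolutelyContinuousOnInterval w₃ 0 L) :
    MemW41 L w₀ ∧ EqOn (D L 2 w₀) w₂ (Icc 0 L) ∧ EqOn (D L 3 w₀) w₃ (Icc 0 L) := by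
  have e₁ : EqOn (D L 1 w₀) w₁ (Icc 0 L) :=
    D_succ_eqOn_of_hasDerivWithinAt hL (k := 0) (by simp [EqOn]) h₀
  have e₂ : EqOn (D L 2 w₀) w₂ (Icc 0 L) := D_succ_eqOn_of_hasDerivWithinAt hL e₁ h₁
  have e₃ : EqOn (D L 3 w₀) w₃ (Icc 0 L) := D_succ_eqOn_of_hasDerivWithinAt hL e₂ h₂
  have hI : uIcc 0 L = Icc 0 L := uIcc_of_le hL.le
  have hc₃ : ContinuousOn w₃ (Icc 0 L) := hI ▸ h₃.continuousOn
  refine ⟨⟨?_, AbsolutelyContinuousOnInterval.congr_of_eqOn h₃ (by rw [hI]; exact e₃.symm)⟩,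
    e₂, e₃⟩
  have := contDiffOn_nat_iff_continuousOn_differentiableOn_deriv (𝕜 := ℝ) (f := w₀) (n := 3)
    (uniqueDiffOn_Icc hL)
  refine this.2 ⟨fun k hk => ?_, fun k hk => ?_⟩
  · change ContinuousOn (D L k w₀) _
    interval_cases k
    · rw [D_zero]; exact fun x hx => (h₀ x hx).continuousWithinAt
    · exact ContinuousOn.congr (fun x hx => (h₁ x hx).continuousWithinAt) e₁
    · exact ContinuousOn.congr (fun x hx => (h₂ x hx).continuousWithinAt) e₂
    · exact hc₃.congr e₃
  · change DifferentiableOn ℝ (D L k w₀) _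
    interval_cases k
    · rw [D_zero]; exact fun x hx => (h₀ x hx).differentiableWithinAt
    · exact DifferentiableOn.congr (fun x hx => (h₁ x hx).differentiableWithinAt) e₁
    · exact DifferentiableOn.congr (fun x hx => (h₂ x hx).differentiableWithinAt) e₂

theorem D_four_eq_of_eqOn {w : ℝ → ℝ} (h : EqOn (D L 3 u) w (Icc 0 L)) {x d : ℝ}
    (hx : x ∈ Ioo 0 L) (hw : HasDerivAt w d x) : D L 4 u x = d :=
  D_four_eq_of_hasDerivAt hx <|
    hw.congr_of_eventuallyEq (h.eventuallyEq_of_mem (Icc_mem_nhds hx.1 hx.2))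

/-- Linear combinations of functions in `W^{4,1}[0, L]`. -/
theorem MemW41.linearCombination (hL : 0 < L) (hu : MemW41 L u) (hv : MemW41 L v) (c d : ℝ) :
    MemW41 L (fun x => c * u x + d * v x) ∧
    (∀ x ∈ Icc 0 L, D L 2 (fun x => c * u x + d * v x) x = c * D L 2 u x + d * D L 2 v x) ∧
    ∀ᵐ x, x ∈ Ioo 0 L →
      D L 4 (fun x => c * u x + d * v x) x = c * D L 4 u x + d * D L 4 v x := by
  have key : ∀ k < 3, ∀ x ∈ Icc 0 L, HasDerivWithinAt (fun x => c * D L k u x + d * D L k v x)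
      (c * D L (k + 1) u x + d * D L (k + 1) v x) (Icc 0 L) x := fun k hk x hx =>
    ((hu.hasDerivWithinAt hL hk hx).const_mul c).add ((hv.hasDerivWithinAt hL hk hx).const_mul d)
  obtain ⟨h1, h2, h3⟩ := memW41_of_hasDerivWithinAt hL (by simpa using key 0 (by norm_num))
    (key 1 (by norm_num)) (key 2 (by norm_num)) ((hu.2.const_mul c).fun_add (hv.2.const_mul d))
  refine ⟨h1, h2, ?_⟩
  filter_upwards [hu.ae_hasDerivAt hL, hv.ae_hasDerivAt hL] with x hxu hxv hx
  exact D_four_eq_of_eqOn h3 hx (((hxu hx).const_mul c).add ((hxv hx).const_mul d))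

theorem Hinged.linearCombination (hL : 0 < L) (hu : MemW41 L u) (hv : MemW41 L v)
    (hu' : Hinged L u) (hv' : Hinged L v) (c d : ℝ) :
    Hinged L (fun x => c * u x + d * v x) := by
  have h := (hu.linearCombination hL hv c d).2.1
  obtain ⟨a1, a2, a3, a4⟩ := hu'
  obtain ⟨b1, b2, b3, b4⟩ := hv'
  refine ⟨by simp [a1, b1], by simp [a2, b2], ?_, ?_⟩
  · rw [h 0 (left_mem_Icc.2 hL.le)]; simp [a3, b3]
  · rw [h L (right_mem_Icc.2 hL.le)]; simp [a4, b4]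

theorem integral_linearCombination (hL : 0 < L) (hu : MemW41 L u) (hv : MemW41 L v) (c d : ℝ) :
    ∫ x in (0 : ℝ)..L, (c * u x + d * v x) =
      c * (∫ x in (0 : ℝ)..L, u x) + d * ∫ x in (0 : ℝ)..L, v x := by
  have iu := hu.intervalIntegrable hL (k := 0) (by norm_num)
  have iv := hv.intervalIntegrable hL (k := 0) (by norm_num)
  rw [D_zero] at iu iv
  rw [intervalIntegral.integral_add (iu.const_mul c) (iv.const_mul d)]
  simp

end Melan

namespace Melan

/-! ### Hyperbolic inequalities -/

/-- The difference vanishes at `0` and has derivative `x sinh x`, positive for `x > 0`. -/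
theorem sinh_lt_mul_cosh {y : ℝ} (hy : 0 < y) : Real.sinh y < y * Real.cosh y := by
  have hd : ∀ x : ℝ, HasDerivAt (fun x => x * Real.cosh x - Real.sinh x) (x * Real.sinh x) x := by
    intro x
    have := ((hasDerivAt_id x).mul (Real.hasDerivAt_cosh x)).sub (Real.hasDerivAt_sinh x)
    convert! this using 1
    simp
  have hmono : StrictMonoOn (fun x => x * Real.cosh x - Real.sinh x) (Ici 0) := by
    apply strictMonoOn_of_deriv_pos (convex_Ici 0)
    · exact fun x _ => (hd x).continuousAt.continuousWithinAt
    · intro x hx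
      rw [interior_Ici] at hx
      rw [(hd x).deriv]
      exact mul_pos hx (Real.sinh_pos_iff.2 hx)
  have := hmono (mem_Ici.2 le_rfl) (mem_Ici.2 hy.le) hy
  simpa using this

/-- The half-angle formulas reduce this to `sinh_lt_mul_cosh` at `t / 2`, up to the factor `4 sinh
(t / 2)`. -/
theorem two_mul_cosh_sub_one_lt {t : ℝ} (ht : 0 < t) :
    2 * (Real.cosh t - 1) < t * Real.sinh t := by
  have h := sinh_lt_mul_cosh (half_pos ht)
  have hs : 0 < Real.sinh (t / 2) := Real.sinh_pos_iff.2 (half_pos ht)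
  have e : t = 2 * (t / 2) := by ring
  rw [e, Real.cosh_two_mul, Real.sinh_two_mul]
  nlinarith [Real.cosh_sq (t / 2)]

/-- `tanh (t / 2)`. -/
noncomputable def halfTanh (t : ℝ) : ℝ := (Real.cosh t - 1) / Real.sinh t

theorem halfTanh_mul_sinh {t : ℝ} (ht : 0 < t) :
    halfTanh t * Real.sinh t = Real.cosh t - 1 :=
  div_mul_cancel₀ _ (Real.sinh_pos_iff.2 ht).ne'

theorem halfTanh_mul_cosh_add_one {t : ℝ} (ht : 0 < t) :
    halfTanh t * (Real.cosh t + 1) = Real.sinh t := by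
  have hs := Real.sinh_pos_iff.2 ht
  rw [halfTanh, div_mul_eq_mul_div, div_eq_iff hs.ne']
  nlinarith [Real.cosh_sq t]

theorem two_mul_halfTanh_lt {t : ℝ} (ht : 0 < t) : 2 * halfTanh t < t := by
  have hs := Real.sinh_pos_iff.2 ht
  have h := two_mul_cosh_sub_one_lt ht
  rw [halfTanh, ← mul_div_assoc, div_lt_iff₀ hs]
  exact h

/-! ### The solution `e` of `-e'' + m² e = 1` and the solution `ψ` of `ψ'''' - m² ψ'' = 1` -/

/-- The solution of `-e'' + m² e = 1`, `e 0 = e L = 0`. -/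
noncomputable def torsion (L m x : ℝ) : ℝ :=
  (1 - Real.cosh (m * x) + halfTanh (m * L) * Real.sinh (m * x)) / m ^ 2

/-- Derivative of `torsion`. -/
noncomputable def torsionDeriv (L m x : ℝ) : ℝ :=
  (-Real.sinh (m * x) + halfTanh (m * L) * Real.cosh (m * x)) / m

/-- The solution of `ψ'''' - m² ψ'' = 1` with hinged ends. -/
noncomputable def unitLoad (L m x : ℝ) : ℝ := (x * (L - x) / 2 - torsion L m x) / m ^ 2

/-- Derivative of `unitLoad`. -/
noncomputable def unitLoadDeriv (L m x : ℝ) : ℝ := ((L - 2 * x) / 2 - torsionDeriv L m x) / m ^ 2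

/-- The integral of `unitLoad` over `[0, L]`. -/
noncomputable def unitLoadIntegral (L m : ℝ) : ℝ :=
  (L ^ 3 / 12 - (L - 2 * halfTanh (m * L) / m) / m ^ 2) / m ^ 2

theorem hasDerivAt_sinh_mul (m x : ℝ) :
    HasDerivAt (fun x => Real.sinh (m * x)) (m * Real.cosh (m * x)) x := by
  have := ((hasDerivAt_id x).const_mul m).sinh
  simpa [mul_comm] using this

theorem hasDerivAt_cosh_mul (m x : ℝ) :
    HasDerivAt (fun x => Real.cosh (m * x)) (m * Real.sinh (m * x)) x := by
  have := ((hasDerivAt_id x).const_mul m).cosh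
  simpa [mul_comm] using this

theorem hasDerivAt_sinh_mul_sub (m L x : ℝ) :
    HasDerivAt (fun x => Real.sinh (m * (L - x))) (-(m * Real.cosh (m * (L - x)))) x := by
  have := (((hasDerivAt_id x).const_sub L).const_mul m).sinh
  simpa [mul_comm] using this

theorem hasDerivAt_cosh_mul_sub (m L x : ℝ) :
    HasDerivAt (fun x => Real.cosh (m * (L - x))) (-(m * Real.sinh (m * (L - x)))) x := by
  have := (((hasDerivAt_id x).const_sub L).const_mul m).cosh
  simpa [mul_comm] using this

variable {L m : ℝ}

theorem hasDerivAt_torsion (hm : 0 < m) (x : ℝ) :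
    HasDerivAt (torsion L m) (torsionDeriv L m x) x := by
  have := (((hasDerivAt_const x (1 : ℝ)).sub (hasDerivAt_cosh_mul m x)).add
    ((hasDerivAt_sinh_mul m x).const_mul (halfTanh (m * L)))).div_const (m ^ 2)
  convert! this using 1
  rw [torsionDeriv]; field_simp; ring

theorem hasDerivAt_torsionDeriv (hm : 0 < m) (x : ℝ) :
    HasDerivAt (torsionDeriv L m) (m ^ 2 * torsion L m x - 1) x := by
  have := ((hasDerivAt_sinh_mul m x).neg.add
    ((hasDerivAt_cosh_mul m x).const_mul (halfTanh (m * L)))).div_const m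
  convert! this using 1
  rw [torsion]; field_simp; ring

theorem hasDerivAt_unitLoad (hm : 0 < m) (x : ℝ) :
    HasDerivAt (unitLoad L m) (unitLoadDeriv L m x) x := by
  have := ((((hasDerivAt_id x).mul ((hasDerivAt_id x).const_sub L)).div_const 2).sub
    (hasDerivAt_torsion (L := L) hm x)).div_const (m ^ 2)
  convert! this using 1
  rw [unitLoadDeriv]; simp; ring

theorem hasDerivAt_unitLoadDeriv (hm : 0 < m) (x : ℝ) :
    HasDerivAt (unitLoadDeriv L m) (-torsion L m x) x := by
  have := (((((hasDerivAt_id x).const_mul 2).const_sub L).div_const 2).sub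
    (hasDerivAt_torsionDeriv (L := L) hm x)).div_const (m ^ 2)
  convert! this using 1
  field_simp; ring

theorem torsion_zero : torsion L m 0 = 0 := by simp [torsion]

theorem torsion_right (hL : 0 < L) (hm : 0 < m) : torsion L m L = 0 := by
  rw [torsion, halfTanh_mul_sinh (mul_pos hm hL)]; simp

theorem unitLoad_zero : unitLoad L m 0 = 0 := by simp [unitLoad, torsion_zero]

theorem unitLoad_right (hL : 0 < L) (hm : 0 < m) : unitLoad L m L = 0 := by
  simp [unitLoad, torsion_right hL hm]

theorem torsion_symm (hL : 0 < L) (hm : 0 < m) (x : ℝ) : torsion L m (L - x) = torsion L m x := by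
  have h1 := halfTanh_mul_sinh (mul_pos hm hL)
  have h2 := halfTanh_mul_cosh_add_one (mul_pos hm hL)
  unfold torsion
  congr 1
  rw [mul_sub, Real.cosh_sub, Real.sinh_sub]
  linear_combination Real.cosh (m * x) * h1 - Real.sinh (m * x) * h2

theorem unitLoad_symm (hL : 0 < L) (hm : 0 < m) (x : ℝ) :
    unitLoad L m (L - x) = unitLoad L m x := by
  unfold unitLoad
  rw [torsion_symm hL hm]; ring

/-- Clearing denominators leaves a combination of `sinh` whose sign the addition formula reveals. -/
theorem torsion_mul (hL : 0 < L) (hm : 0 < m) (x : ℝ) :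
    m ^ 2 * Real.sinh (m * L) * torsion L m x =
      Real.sinh (m * L) - Real.sinh (m * (L - x)) - Real.sinh (m * x) := by
  have h1 := halfTanh_mul_sinh (mul_pos hm hL)
  unfold torsion
  rw [mul_sub, Real.sinh_sub]
  field_simp
  linear_combination Real.sinh (m * x) * h1

theorem torsion_nonneg (hL : 0 < L) (hm : 0 < m) {x : ℝ} (hx : x ∈ Icc 0 L) :
    0 ≤ torsion L m x := by
  have hs := Real.sinh_pos_iff.2 (mul_pos hm hL)
  have h := torsion_mul hL hm x
  have h1 : 0 ≤ Real.sinh (m * x) := Real.sinh_nonneg_iff.2 (mul_nonneg hm.le hx.1)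
  have h2 : 0 ≤ Real.sinh (m * (L - x)) :=
    Real.sinh_nonneg_iff.2 (mul_nonneg hm.le (sub_nonneg.2 hx.2))
  have h3 : Real.sinh (m * L) = Real.sinh (m * (L - x)) * Real.cosh (m * x) +
      Real.cosh (m * (L - x)) * Real.sinh (m * x) := by
    rw [← Real.sinh_add]; congr 1; ring
  -- In the addition formula for `sinh (m L)` both `cosh` factors are at least `1`.
  have h4 : 0 ≤ m ^ 2 * Real.sinh (m * L) * torsion L m x := by
    nlinarith [Real.one_le_cosh (m * x), Real.one_le_cosh (m * (L - x))]
  exact nonneg_of_mul_nonneg_right h4 (by positivity)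

/-- The bound has the value and slope of `torsion` at `0`, so no smaller multiple of `sinh (m x)`
works near that end. -/
theorem torsion_le (hm : 0 < m) (x : ℝ) :
    torsion L m x ≤ halfTanh (m * L) * Real.sinh (m * x) / m ^ 2 := by
  unfold torsion
  gcongr
  linarith [Real.one_le_cosh (m * x)]

/-- The coefficient of `sinh (m x)` again matches the slope at `0`. -/
theorem unitLoad_le (hm : 0 < m) {x : ℝ} (hx : x ∈ Icc 0 L) :
    unitLoad L m x ≤ (L / 2 - halfTanh (m * L) / m) / m ^ 3 * Real.sinh (m * x) := by
  have hmx : 0 ≤ m * x := mul_nonneg hm.le hx.1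
  have h1 : 2 * (Real.cosh (m * x) - 1) ≤ m * x * Real.sinh (m * x) := by
    rcases hmx.eq_or_lt with h | h
    · rw [← h]; simp
    · exact (two_mul_cosh_sub_one_lt h).le
  have h2 : m * x ≤ Real.sinh (m * x) := Real.self_le_sinh_iff.2 hmx
  have h3 : 0 ≤ (L - x) * m * (Real.sinh (m * x) - m * x) :=
    mul_nonneg (mul_nonneg (sub_nonneg.2 hx.2) hm.le) (sub_nonneg.2 h2)
  -- The gap splits into two terms, nonnegative by `m x ≤ sinh (m x)` and by
  -- `two_mul_cosh_sub_one_lt`.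
  have e : (L / 2 - halfTanh (m * L) / m) / m ^ 3 * Real.sinh (m * x) - unitLoad L m x =
      ((L - x) * m * (Real.sinh (m * x) - m * x) +
        (m * x * Real.sinh (m * x) - 2 * (Real.cosh (m * x) - 1))) / (2 * m ^ 4) := by
    unfold unitLoad torsion
    field_simp
    ring
  have : 0 ≤ (L / 2 - halfTanh (m * L) / m) / m ^ 3 * Real.sinh (m * x) - unitLoad L m x := by
    rw [e]; apply div_nonneg <;> [linarith; positivity]
  linarith

theorem integral_unitLoad (hL : 0 < L) (hm : 0 < m) :
    ∫ x in (0 : ℝ)..L, unitLoad L m x = unitLoadIntegral L m := by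
  have hd : ∀ x ∈ uIcc 0 L, HasDerivAt (fun x : ℝ => (L * x ^ 2 / 4 - x ^ 3 / 6 -
      (x - Real.sinh (m * x) / m + halfTanh (m * L) * Real.cosh (m * x) / m) / m ^ 2) / m ^ 2)
      (unitLoad L m x) x := by
    intro x _
    have := (((((hasDerivAt_pow 2 x).const_mul L).div_const 4).sub
      ((hasDerivAt_pow 3 x).div_const 6)).sub
      ((((hasDerivAt_id x).sub ((hasDerivAt_sinh_mul m x).div_const m)).add
      (((hasDerivAt_cosh_mul m x).const_mul (halfTanh (m * L))).div_const m)).div_const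
        (m ^ 2))).div_const (m ^ 2)
    convert! this using 1
    rw [unitLoad, torsion]; simp; field_simp; ring
  have hc : Continuous (unitLoad L m) :=
    continuous_iff_continuousAt.2 fun x => (hasDerivAt_unitLoad hm x).continuousAt
  rw [intervalIntegral.integral_eq_sub_of_hasDerivAt hd (hc.intervalIntegrable _ _)]
  have h1 := halfTanh_mul_cosh_add_one (mul_pos hm hL)
  rw [unitLoadIntegral]
  simp only [mul_zero, Real.sinh_zero, Real.cosh_zero]
  -- Only the relation `T (C + 1) = S` matters from here on; the rest is algebra in independent
  -- symbols.
  generalize halfTanh (m * L) = T at h1 ⊢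
  generalize Real.cosh (m * L) = C at h1 ⊢
  generalize Real.sinh (m * L) = S at h1 ⊢
  field_simp
  linear_combination (-288) * h1

/-- Since `ψ'' = -e`, the equation for `ψ` is the equation `-e'' + m² e = 1` for `e`. -/
theorem memW41_unitLoad (hL : 0 < L) (hm : 0 < m) :
    MemW41 L (unitLoad L m) ∧ Hinged L (unitLoad L m) ∧
      (∀ x ∈ Icc 0 L, D L 2 (unitLoad L m) x = -torsion L m x) ∧
      ∀ x ∈ Ioo 0 L, D L 4 (unitLoad L m) x - m ^ 2 * D L 2 (unitLoad L m) x = 1 := by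
  obtain ⟨h1, h2, h3⟩ := memW41_of_hasDerivWithinAt hL
    (fun x _ => (hasDerivAt_unitLoad (L := L) hm x).hasDerivWithinAt)
    (fun x _ => (hasDerivAt_unitLoadDeriv hm x).hasDerivWithinAt)
    (fun x _ => (hasDerivAt_torsion hm x).neg.hasDerivWithinAt)
    (absolutelyContinuousOnInterval_of_hasDerivWithinAt hL
      (fun x _ => (hasDerivAt_torsionDeriv hm x).neg.hasDerivWithinAt)
      (fun x _ => ((((hasDerivAt_torsion hm x).const_mul (m ^ 2)).sub_const 1).neg
        |>.continuousAt.continuousWithinAt)))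
  refine ⟨h1, ⟨unitLoad_zero, unitLoad_right hL hm, ?_, ?_⟩, h2, fun x hx => ?_⟩
  · simp [h2 (left_mem_Icc.2 hL.le), torsion_zero]
  · simp [h2 (right_mem_Icc.2 hL.le), torsion_right hL hm]
  · rw [D_four_eq_of_eqOn h3 hx (hasDerivAt_torsionDeriv hm x).neg,
      h2 (Ioo_subset_Icc_self hx)]
    ring

/-! ### Green's identities -/

variable {w : ℝ → ℝ}

theorem intervalIntegrable_source (hL : 0 < L) (hw : MemW41 L w) :
    IntervalIntegrable (fun s => D L 4 w s - m ^ 2 * D L 2 w s) volume 0 L :=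
  (hw.intervalIntegrable_D_four hL).sub ((hw.intervalIntegrable hL (by norm_num)).const_mul _)

/-- Green's identity for `w'''' - m² w''` against a solution of `κ'' = m² κ`. -/
theorem integral_mul_source (hL : 0 < L) (hw : MemW41 L w) {κ κ' : ℝ → ℝ}
    (hκ : ∀ s, HasDerivAt κ (κ' s) s) (hκ' : ∀ s, HasDerivAt κ' (m ^ 2 * κ s) s) {x y : ℝ}
    (hx : 0 ≤ x) (hxy : x ≤ y) (hy : y ≤ L) :
    ∫ s in x..y, κ s * (D L 4 w s - m ^ 2 * D L 2 w s) =
      (κ y * D L 3 w y - κ' y * D L 2 w y) - (κ x * D L 3 w x - κ' x * D L 2 w x) := by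
  have aκ : AbsolutelyContinuousOnInterval κ 0 L :=
    absolutelyContinuousOnInterval_of_hasDerivWithinAt hL (fun x _ => (hκ x).hasDerivWithinAt)
      fun x _ => (hκ' x).continuousAt.continuousWithinAt
  have aκ' : AbsolutelyContinuousOnInterval κ' 0 L :=
    absolutelyContinuousOnInterval_of_hasDerivWithinAt hL (fun x _ => (hκ' x).hasDerivWithinAt)
      fun x _ => ((hκ x).const_mul (m ^ 2)).continuousAt.continuousWithinAt
  -- The primitive is `κ w''' - κ' w''`: the terms `κ' w'''` cancel on differentiation, and `κ'' =
  -- m² κ` does the rest.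
  have aF := ((aκ.fun_mul hw.2).fun_sub
    (aκ'.fun_mul (hw.absolutelyContinuous hL (k := 2) (by norm_num)))).mono
    (c := x) (d := y) (by
      rw [uIcc_of_le hxy, uIcc_of_le hL.le]; exact Icc_subset_Icc hx hy)
  refine (integral_eq_sub_of_ae_hasDerivAt hxy aF ?_).2
  filter_upwards [hw.ae_hasDerivAt hL] with s hs hmem
  have hs' : s ∈ Ioo 0 L := ⟨hx.trans_lt hmem.1, hmem.2.trans_le hy⟩
  have := ((hκ s).mul (hs hs')).sub ((hκ' s).mul (hw.hasDerivAt hL (k := 2) (by norm_num) hs'))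
  convert! this using 1
  ring

/-- Green's representation of `-w''` through `w'''' - m² w''`. -/
theorem green_representation (hL : 0 < L) (hw : MemW41 L w) (h0 : D L 2 w 0 = 0)
    (h1 : D L 2 w L = 0) {x : ℝ} (hx : x ∈ Icc 0 L) :
    m * Real.sinh (m * L) * (-D L 2 w x) =
      Real.sinh (m * (L - x)) *
        (∫ s in (0 : ℝ)..x, Real.sinh (m * s) * (D L 4 w s - m ^ 2 * D L 2 w s)) +
      Real.sinh (m * x) *
        ∫ s in x..L, Real.sinh (m * (L - s)) * (D L 4 w s - m ^ 2 * D L 2 w s) := by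
  -- The kernels vanish at `0` and at `L` respectively. In the combination the `w''' x` terms
  -- cancel, and the addition formula collects those with `w'' x`.
  rw [integral_mul_source hL hw (κ' := fun s => m * Real.cosh (m * s)) (hasDerivAt_sinh_mul m)
      (fun s => by
        convert! (hasDerivAt_cosh_mul m s).const_mul m using 1; ring) le_rfl hx.1 hx.2,
    integral_mul_source hL hw (κ' := fun s => -(m * Real.cosh (m * (L - s))))
      (hasDerivAt_sinh_mul_sub m L)
      (fun s => by
        convert! ((hasDerivAt_cosh_mul_sub m L s).const_mul m).neg using 1; ring)
      hx.1 hx.2 le_rfl, h0, h1]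
  have h3 : Real.sinh (m * L) = Real.sinh (m * (L - x)) * Real.cosh (m * x) +
      Real.cosh (m * (L - x)) * Real.sinh (m * x) := by
    rw [← Real.sinh_add]; congr 1; ring
  rw [h3]
  simp
  ring

/-- Testing `w'''' - m² w''` against `unitLoad` gives the integral of `w`. -/
theorem integral_unitLoad_mul_source (hL : 0 < L) (hm : 0 < m) (hw : MemW41 L w)
    (hw' : Hinged L w) :
    ∫ s in (0 : ℝ)..L, unitLoad L m s * (D L 4 w s - m ^ 2 * D L 2 w s) =
      ∫ s in (0 : ℝ)..L, w s := by
  have ct : Continuous (torsion L m) :=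
    continuous_iff_continuousAt.2 fun x => (hasDerivAt_torsion hm x).continuousAt
  have ct' : Continuous (torsionDeriv L m) :=
    continuous_iff_continuousAt.2 fun x => (hasDerivAt_torsionDeriv hm x).continuousAt
  have cu' : Continuous (unitLoadDeriv L m) :=
    continuous_iff_continuousAt.2 fun x => (hasDerivAt_unitLoadDeriv hm x).continuousAt
  have a0 := absolutelyContinuousOnInterval_of_hasDerivWithinAt hL
    (fun x _ => (hasDerivAt_unitLoad (L := L) hm x).hasDerivWithinAt) cu'.continuousOn
  have a1 := absolutelyContinuousOnInterval_of_hasDerivWithinAt hL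
    (fun x _ => (hasDerivAt_unitLoadDeriv (L := L) hm x).hasDerivWithinAt) ct.neg.continuousOn
  have a2 := absolutelyContinuousOnInterval_of_hasDerivWithinAt hL
    (fun x _ => (hasDerivAt_torsion (L := L) hm x).hasDerivWithinAt) ct'.continuousOn
  have a3 := absolutelyContinuousOnInterval_of_hasDerivWithinAt hL
    (fun x _ => (hasDerivAt_torsionDeriv (L := L) hm x).hasDerivWithinAt)
    ((ct.const_mul (m ^ 2)).sub continuous_const).continuousOn
  have b0 := hw.absolutelyContinuous hL (k := 0) (by norm_num)
  have b1 := hw.absolutelyContinuous hL (k := 1) (by norm_num)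
  have b2 := hw.absolutelyContinuous hL (k := 2) (by norm_num)
  -- This is the boundary form of the self-adjoint operator `w'''' - m² w''`; it vanishes at both
  -- ends because `w` and `ψ` are hinged.
  have aF := ((((a0.fun_mul hw.2).fun_sub (a1.fun_mul b2)).fun_sub (a2.fun_mul b1)).fun_add
    (a3.fun_mul b0)).fun_sub (((a0.fun_mul b1).fun_sub (a1.fun_mul b0)).const_mul (m ^ 2))
  have key := integral_eq_sub_of_ae_hasDerivAt (F' := fun s =>
    unitLoad L m s * (D L 4 w s - m ^ 2 * D L 2 w s) - w s) hL.le aF (by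
      filter_upwards [hw.ae_hasDerivAt hL] with s hs hmem
      have d0 := hw.hasDerivAt hL (k := 0) (by norm_num) hmem
      have d1 := hw.hasDerivAt hL (k := 1) (by norm_num) hmem
      have d2 := hw.hasDerivAt hL (k := 2) (by norm_num) hmem
      have p0 := hasDerivAt_unitLoad (L := L) hm s
      have p1 := hasDerivAt_unitLoadDeriv (L := L) hm s
      have p2 := hasDerivAt_torsion (L := L) hm s
      have p3 := hasDerivAt_torsionDeriv (L := L) hm s
      have := ((((p0.mul (hs hmem)).sub (p1.mul d2)).sub (p2.mul d1)).add
        (p3.mul d0)).sub (((p0.mul d1).sub (p1.mul d0)).const_mul (m ^ 2))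
      convert! this using 1
      simp only [D_zero]
      ring)
  have hI := (intervalIntegrable_source (m := m) hL hw).continuousOn_mul
    (g := unitLoad L m) (fun x _ => (hasDerivAt_unitLoad hm x).continuousAt.continuousWithinAt)
  have hi := hw.intervalIntegrable hL (k := 0) (by norm_num)
  rw [D_zero] at hi
  have h := key.2
  rw [intervalIntegral.integral_sub hI hi] at h
  obtain ⟨w0, w1, w2, w3⟩ := hw'
  simp [w0, w1, w2, w3, unitLoad_zero, unitLoad_right hL hm, torsion_zero,
    torsion_right hL hm] at h
  linarith

end Melan

/-! ### Inverse positivity and comparison -/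

namespace Melan

variable {L m : ℝ} {w : ℝ → ℝ}

/-- The condition on `N` under which `w'''' - m² w'' + N ∫ w` is inverse positive. -/
def Admissible (L m N : ℝ) : Prop :=
  N * ((Real.cosh (m * L) - 1) * (L / 2 - halfTanh (m * L) / m) / m ^ 4) ≤
    1 + N * unitLoadIntegral L m

theorem half_sub_halfTanh_div_pos (hL : 0 < L) (hm : 0 < m) :
    0 < L / 2 - halfTanh (m * L) / m := by
  have := two_mul_halfTanh_lt (mul_pos hm hL)
  rw [sub_pos, div_lt_div_iff₀ hm two_pos]
  linarith

/-- The `σ` threshold is `12 m⁵ / den`, and the two sides of `Admissible` differ by exactly `1 - N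
den / (12 m⁵)`. -/
theorem admissible_of_le_sigma (hL : 0 < L) (hm : 0 < m) {N : ℝ} (hN : 0 < N)
    (h : N ≤ 4 * m ^ 2 / L ^ 3 * σ (m * L)) : Admissible L m N := by
  unfold σ at h
  have ht := mul_pos hm hL
  set den := 6 * (m * L) * Real.cosh (m * L) + 6 * (m * L) - 12 * Real.sinh (m * L) - (m * L) ^ 3
    with hden
  -- Otherwise the threshold would be nonpositive (division by zero gives `0`), against `N > 0`.
  have hpos : 0 < den := by
    by_contra hc
    have : 4 * m ^ 2 / L ^ 3 * (3 * (m * L) ^ 3 / den) ≤ 0 :=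
      mul_nonpos_of_nonneg_of_nonpos (by positivity)
        (div_nonpos_of_nonneg_of_nonpos (by positivity) (not_lt.1 hc))
    linarith
  have e1 : 4 * m ^ 2 / L ^ 3 * (3 * (m * L) ^ 3 / den) = 12 * m ^ 5 / den := by
    field_simp; ring
  rw [e1, le_div_iff₀ hpos] at h
  have h1 := halfTanh_mul_cosh_add_one ht
  unfold Admissible unitLoadIntegral
  have e2 : 1 + N * ((L ^ 3 / 12 - (L - 2 * halfTanh (m * L) / m) / m ^ 2) / m ^ 2) -
      N * ((Real.cosh (m * L) - 1) * (L / 2 - halfTanh (m * L) / m) / m ^ 4) =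
      (12 * m ^ 5 - N * den) / (12 * m ^ 5) := by
    rw [hden]
    generalize halfTanh (m * L) = T at h1 ⊢
    generalize Real.cosh (m * L) = C at h1 ⊢
    generalize Real.sinh (m * L) = S at h1 ⊢
    field_simp
    linear_combination 24 * N * h1
  have : 0 ≤ (12 * m ^ 5 - N * den) / (12 * m ^ 5) :=
    div_nonneg (sub_nonneg.2 h) (by positivity)
  linarith

theorem Admissible.one_add_pos (hL : 0 < L) (hm : 0 < m) {N : ℝ} (hN : 0 < N)
    (h : Admissible L m N) : 0 < 1 + N * unitLoadIntegral L m := by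
  refine lt_of_lt_of_le ?_ h
  have h1 := half_sub_halfTanh_div_pos hL hm
  have h2 : 0 < Real.cosh (m * L) - 1 := sub_pos.2 (Real.one_lt_cosh.2 (mul_pos hm hL).ne')
  positivity

/-- Quantitative positivity: `w'''' - m² w'' ≥ 0` bounds `-w''` below by the mean of `w`. -/
theorem torsion_mul_integral_le (hL : 0 < L) (hm : 0 < m) (hw : MemW41 L w) (hw' : Hinged L w)
    (h : ∀ᵐ x, x ∈ Ioo 0 L → 0 ≤ D L 4 w x - m ^ 2 * D L 2 w x) {x : ℝ} (hx : x ∈ Icc 0 L) :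
    D L 2 w x ≤ 0 ∧
    torsion L m x * (∫ s in (0 : ℝ)..L, w s) ≤
      (Real.cosh (m * L) - 1) * (L / 2 - halfTanh (m * L) / m) / m ^ 4 * (-D L 2 w x) := by
  set H : ℝ → ℝ := fun s => D L 4 w s - m ^ 2 * D L 2 w s with hH
  have iH : IntervalIntegrable H volume 0 L := intervalIntegrable_source hL hw
  have s0 : uIcc 0 x ⊆ uIcc 0 L := by
    rw [uIcc_of_le hx.1, uIcc_of_le hL.le]; exact Icc_subset_Icc le_rfl hx.2
  have s1 : uIcc x L ⊆ uIcc 0 L := by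
    rw [uIcc_of_le hx.2, uIcc_of_le hL.le]; exact Icc_subset_Icc hx.1 le_rfl
  have iH0 : IntervalIntegrable H volume 0 x := iH.mono_set s0
  have iH1 : IntervalIntegrable H volume x L := iH.mono_set s1
  have cS : Continuous fun s : ℝ => Real.sinh (m * s) := by fun_prop
  have cS' : Continuous fun s : ℝ => Real.sinh (m * (L - s)) := by fun_prop
  have cU : Continuous (unitLoad L m) :=
    continuous_iff_continuousAt.2 fun x => (hasDerivAt_unitLoad hm x).continuousAt
  have rep := green_representation (m := m) hL hw hw'.2.2.1 hw'.2.2.2 hx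
  have rint := integral_unitLoad_mul_source hL hm hw hw'
  have nonneg_ae : ∀ a b : ℝ, 0 ≤ a → b ≤ L → ∀ᵐ s ∂volume, s ∈ Ioc a b → 0 ≤ H s := by
    intro a b ha hb
    have hne : ∀ᵐ s : ℝ, s ≠ L := by simp [ae_iff, measure_singleton]
    filter_upwards [h, hne] with s hs hsL hmem
    exact hs ⟨ha.trans_lt hmem.1, lt_of_le_of_ne (hmem.2.trans hb) hsL⟩
  -- `Q` is the coefficient from `unitLoad_le`. It serves at both ends because `unitLoad` is
  -- symmetric about `L / 2`.
  set Q := (L / 2 - halfTanh (m * L) / m) / m ^ 3 with hQ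
  have hQ0 : 0 ≤ Q := by
    have := half_sub_halfTanh_div_pos hL hm
    positivity
  have hA : 0 ≤ ∫ s in (0 : ℝ)..x, Real.sinh (m * s) * H s := by
    apply intervalIntegral.integral_nonneg_of_ae_restrict hx.1
    rw [EventuallyLE, ← restrict_Ioc_eq_restrict_Icc, ae_restrict_iff' measurableSet_Ioc]
    filter_upwards [nonneg_ae 0 x le_rfl hx.2] with s hs hmem
    exact mul_nonneg (Real.sinh_nonneg_iff.2 (mul_nonneg hm.le hmem.1.le)) (hs hmem)
  have hB : 0 ≤ ∫ s in x..L, Real.sinh (m * (L - s)) * H s := by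
    apply intervalIntegral.integral_nonneg_of_ae_restrict hx.2
    rw [EventuallyLE, ← restrict_Ioc_eq_restrict_Icc, ae_restrict_iff' measurableSet_Ioc]
    filter_upwards [nonneg_ae x L hx.1 le_rfl] with s hs hmem
    exact mul_nonneg (Real.sinh_nonneg_iff.2 (mul_nonneg hm.le (sub_nonneg.2 hmem.2))) (hs hmem)
  have hA' : ∫ s in (0 : ℝ)..x, unitLoad L m s * H s ≤
      Q * ∫ s in (0 : ℝ)..x, Real.sinh (m * s) * H s := by
    rw [← intervalIntegral.integral_const_mul]
    apply intervalIntegral.integral_mono_ae_restrict hx.1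
      (iH0.continuousOn_mul cU.continuousOn)
      ((iH0.continuousOn_mul cS.continuousOn).const_mul Q)
    rw [EventuallyLE, ← restrict_Ioc_eq_restrict_Icc, ae_restrict_iff' measurableSet_Ioc]
    filter_upwards [nonneg_ae 0 x le_rfl hx.2] with s hs hmem
    rw [← mul_assoc]
    exact mul_le_mul_of_nonneg_right (unitLoad_le hm ⟨hmem.1.le, hmem.2.trans hx.2⟩) (hs hmem)
  have hB' : ∫ s in x..L, unitLoad L m s * H s ≤
      Q * ∫ s in x..L, Real.sinh (m * (L - s)) * H s := by
    rw [← intervalIntegral.integral_const_mul]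
    apply intervalIntegral.integral_mono_ae_restrict hx.2
      (iH1.continuousOn_mul cU.continuousOn)
      ((iH1.continuousOn_mul cS'.continuousOn).const_mul Q)
    rw [EventuallyLE, ← restrict_Ioc_eq_restrict_Icc, ae_restrict_iff' measurableSet_Ioc]
    filter_upwards [nonneg_ae x L hx.1 le_rfl] with s hs hmem
    rw [← mul_assoc, ← unitLoad_symm hL hm]
    exact mul_le_mul_of_nonneg_right
      (unitLoad_le hm ⟨sub_nonneg.2 hmem.2, by linarith [hx.1, hmem.1]⟩) (hs hmem)
  rw [← intervalIntegral.integral_add_adjacent_intervals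
    (iH0.continuousOn_mul cU.continuousOn) (iH1.continuousOn_mul cU.continuousOn)] at rint
  set A := ∫ s in (0 : ℝ)..x, Real.sinh (m * s) * H s
  set B := ∫ s in x..L, Real.sinh (m * (L - s)) * H s
  have hst : 0 < Real.sinh (m * L) := Real.sinh_pos_iff.2 (mul_pos hm hL)
  have hS1 : 0 ≤ Real.sinh (m * x) := Real.sinh_nonneg_iff.2 (mul_nonneg hm.le hx.1)
  have hS2 : 0 ≤ Real.sinh (m * (L - x)) :=
    Real.sinh_nonneg_iff.2 (mul_nonneg hm.le (sub_nonneg.2 hx.2))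
  have hz : 0 ≤ -D L 2 w x := by
    have : 0 ≤ m * Real.sinh (m * L) * (-D L 2 w x) := by rw [rep]; positivity
    exact nonneg_of_mul_nonneg_right this (by positivity)
  refine ⟨by linarith, ?_⟩
  have he := torsion_nonneg hL hm hx
  have e1 := torsion_le (L := L) hm x
  have e2 := torsion_le (L := L) hm (L - x)
  rw [torsion_symm hL hm] at e2
  -- Bounding `torsion` by the `sinh (m (L - x))` multiple next to `A` and the `sinh (m x)` multiple
  -- next to `B` reproduces Green's formula for `-w''`.
  calc torsion L m x * (∫ s in (0 : ℝ)..L, w s)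
      ≤ torsion L m x * (Q * (A + B)) := by
        apply mul_le_mul_of_nonneg_left _ he
        linarith
    _ = Q * (torsion L m x * A + torsion L m x * B) := by ring
    _ ≤ Q * (halfTanh (m * L) * Real.sinh (m * (L - x)) / m ^ 2 * A +
          halfTanh (m * L) * Real.sinh (m * x) / m ^ 2 * B) := by gcongr
    _ = Q * halfTanh (m * L) / m ^ 2 * (m * Real.sinh (m * L) * (-D L 2 w x)) := by
        rw [rep]; ring
    _ = _ := by
        rw [← halfTanh_mul_sinh (mul_pos hm hL), hQ]
        field_simp

/-- Maximum principle: `w'' ≤ 0` with vanishing boundary values forces `w ≥ 0`. -/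
theorem nonneg_of_D_two_nonpos (hL : 0 < L) (hw : MemW41 L w) (h0 : w 0 = 0) (h1 : w L = 0)
    (h : ∀ x ∈ Icc 0 L, D L 2 w x ≤ 0) {x : ℝ} (hx : x ∈ Icc 0 L) : 0 ≤ w x := by
  have hc : ConcaveOn ℝ (Icc 0 L) w := by
    apply concaveOn_of_hasDerivWithinAt2_nonpos (f' := D L 1 w) (f'' := D L 2 w) (convex_Icc 0 L)
    · simpa using hw.continuousOn hL (k := 0) (by norm_num)
    · rw [interior_Icc]
      intro y hy
      simpa using (hw.hasDerivAt hL (k := 0) (by norm_num) hy).hasDerivWithinAt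
    · rw [interior_Icc]
      intro y hy
      exact (hw.hasDerivAt hL (k := 1) (by norm_num) hy).hasDerivWithinAt
    · rw [interior_Icc]
      exact fun y hy => h y (Ioo_subset_Icc_self hy)
  have := hc.min_le_of_mem_Icc (left_mem_Icc.2 hL.le) (right_mem_Icc.2 hL.le) hx
  simpa [h0, h1] using this

/-- Inverse positivity of `G w = w'''' - m² w'' + N ∫ w` with hinged ends. -/
theorem inverse_positivity (hL : 0 < L) (hm : 0 < m) {N : ℝ} (hN : 0 < N)
    (hA : Admissible L m N) (hw : MemW41 L w) (hw' : Hinged L w)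
    (h : ∀ᵐ x, x ∈ Ioo 0 L → 0 ≤ G L (m ^ 2) N w x) {x : ℝ} (hx : x ∈ Icc 0 L) :
    0 ≤ w x ∧ D L 2 w x ≤ 0 := by
  suffices H : ∀ x ∈ Icc 0 L, D L 2 w x ≤ 0 from
    ⟨nonneg_of_D_two_nonpos hL hw hw'.1 hw'.2.1 H hx, H x hx⟩
  intro x hx
  obtain ⟨p1, p2, p3, p4⟩ := memW41_unitLoad hL hm
  set I := ∫ s in (0 : ℝ)..L, w s with hI
  -- Adding `N I ψ` turns the nonlocal operator into `w'''' - m² w''` and multiplies the integral by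
  -- `1 + N ∫ ψ`.
  obtain ⟨q1, q2, q3⟩ := hw.linearCombination hL p1 1 (N * I)
  have q4 := hw'.linearCombination hL hw p1 p2 1 (N * I)
  have q5 := integral_linearCombination hL hw p1 1 (N * I)
  rw [integral_unitLoad hL hm, ← hI] at q5
  obtain ⟨r1, r2⟩ := torsion_mul_integral_le hL hm q1 q4 (by
    filter_upwards [h, q3] with s hs hs3 hmem
    have h1 := hs hmem
    unfold G at h1
    rw [hs3 hmem, q2 s (Ioo_subset_Icc_self hmem)]
    have h2 := p4 s hmem
    linear_combination h1 + (-(N * I)) * h2) hx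
  rw [q5, q2 x hx, p3 x hx] at r2
  rw [q2 x hx, p3 x hx] at r1
  have hK := hA.one_add_pos hL hm hN
  -- The multiplier is `-v''` for `v = w + N I ψ`. Chaining with `N` times the quantitative bound
  -- eliminates the constant `C`.
  have h1 := mul_le_mul_of_nonneg_right hA (a := -(1 * D L 2 w x + N * I * -torsion L m x))
    (by linarith)
  have h2 := mul_le_mul_of_nonneg_left r2 hN.le
  have h3 : (1 + N * unitLoadIntegral L m) * D L 2 w x ≤ 0 := by linarith
  exact nonpos_of_mul_nonpos_right h3 hK

/-- Comparison principle for `G`. -/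
theorem precedes_of_G_le (hL : 0 < L) (hm : 0 < m) {N : ℝ} (hN : 0 < N)
    (hA : Admissible L m N) {u v : ℝ → ℝ} (hu : MemW41 L u) (hu' : Hinged L u)
    (hv : MemW41 L v) (hv' : Hinged L v)
    (h : ∀ᵐ x, x ∈ Ioo 0 L → G L (m ^ 2) N u x ≤ G L (m ^ 2) N v x) : Precedes L u v := by
  intro x hx
  obtain ⟨q1, q2, q3⟩ := hv.linearCombination hL hu 1 (-1)
  have q5 := integral_linearCombination hL hv hu 1 (-1)
  have := inverse_positivity hL hm hN hA q1 (hv'.linearCombination hL hv hu hu' 1 (-1)) (by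
    filter_upwards [h, q3] with s hs hs3 hmem
    have h1 := hs hmem
    unfold G at h1 ⊢
    rw [hs3 hmem, q2 s (Ioo_subset_Icc_self hmem), q5]
    linarith) hx
  rw [q2 x hx] at this
  exact ⟨by linarith [this.1], by linarith [this.2]⟩

end Melan

/-! ### Linear solvability and a priori bounds -/

namespace Melan

variable {L m : ℝ} {w : ℝ → ℝ}

theorem hasDerivAt_integral_of_continuous {q : ℝ → ℝ} (hq : Continuous q) (x : ℝ) :
    HasDerivAt (fun y => ∫ s in (0 : ℝ)..y, q s) (q x) x :=
  intervalIntegral.integral_hasDerivAt_right (hq.intervalIntegrable _ _)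
    (hq.stronglyMeasurableAtFilter _ _) hq.continuousAt

/-- Solvability of `y'' - m² y = m² q`, `y 0 = 0`, with a prescribed value at `L`. -/
theorem exists_solution_second_order (hL : 0 < L) (hm : 0 < m) {q : ℝ → ℝ} (hq : Continuous q)
    (r : ℝ) : ∃ y y' : ℝ → ℝ, y 0 = 0 ∧ y L = r ∧ (∀ x, HasDerivAt y (y' x) x) ∧
      ∀ x, HasDerivAt y' (m ^ 2 * (y x + q x)) x := by
  -- Variation of constants with kernel `m sinh (m (x - s))`, expanded so that `x` leaves the
  -- integrals; `A` is fixed by the value at `L`.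
  set C : ℝ → ℝ := fun x => ∫ s in (0 : ℝ)..x, Real.cosh (m * s) * q s
  set S : ℝ → ℝ := fun x => ∫ s in (0 : ℝ)..x, Real.sinh (m * s) * q s
  have hC : ∀ x, HasDerivAt C (Real.cosh (m * x) * q x) x := fun x =>
    hasDerivAt_integral_of_continuous (q := fun s => Real.cosh (m * s) * q s) (by fun_prop) x
  have hS : ∀ x, HasDerivAt S (Real.sinh (m * x) * q x) x := fun x =>
    hasDerivAt_integral_of_continuous (q := fun s => Real.sinh (m * s) * q s) (by fun_prop) x
  have hC0 : C 0 = 0 := by simp [C]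
  have hS0 : S 0 = 0 := by simp [S]
  have hst : Real.sinh (m * L) ≠ 0 := (Real.sinh_pos_iff.2 (mul_pos hm hL)).ne'
  set A := (r - m * Real.sinh (m * L) * C L + m * Real.cosh (m * L) * S L) / Real.sinh (m * L)
    with hA
  refine ⟨fun x => m * (Real.sinh (m * x) * C x) - m * (Real.cosh (m * x) * S x) +
      A * Real.sinh (m * x),
    fun x => m ^ 2 * (Real.cosh (m * x) * C x) - m ^ 2 * (Real.sinh (m * x) * S x) +
      A * m * Real.cosh (m * x), ?_, ?_, fun x => ?_, fun x => ?_⟩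
  · simp [hS0]
  · simp only [hA]; field_simp; ring
  · have := ((((hasDerivAt_sinh_mul m x).mul (hC x)).const_mul m).sub
      (((hasDerivAt_cosh_mul m x).mul (hS x)).const_mul m)).add
      ((hasDerivAt_sinh_mul m x).const_mul A)
    convert! this using 1
    ring
  · have := ((((hasDerivAt_cosh_mul m x).mul (hC x)).const_mul (m ^ 2)).sub
      (((hasDerivAt_sinh_mul m x).mul (hS x)).const_mul (m ^ 2))).add
      ((hasDerivAt_cosh_mul m x).const_mul (A * m))
    convert! this using 1
    linear_combination (-(m ^ 2 * q x)) * Real.cosh_sq_sub_sinh_sq (m * x)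

/-- Solvability of `w'''' - m² w'' = g` with hinged ends, for integrable `g`. -/
theorem exists_hinged_solution (hL : 0 < L) (hm : 0 < m) {g : ℝ → ℝ}
    (hg : IntervalIntegrable g volume 0 L) :
    ∃ w, MemW41 L w ∧ Hinged L w ∧
      ∀ᵐ x, x ∈ Ioo 0 L → D L 4 w x - m ^ 2 * D L 2 w x = g x := by
  -- Truncation makes the datum integrable on the whole line, so its primitive is continuous
  -- everywhere.
  set g' : ℝ → ℝ := indicator (Ioc 0 L) g with hg'
  have ig' : Integrable g' := by
    rw [hg', integrable_indicator_iff measurableSet_Ioc]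
    exact (intervalIntegrable_iff_integrableOn_Ioc_of_le hL.le).1 hg
  set P : ℝ → ℝ := fun x => ∫ s in (0 : ℝ)..x, g' s with hP
  have cP : Continuous P :=
    intervalIntegral.continuous_primitive (fun a b => ig'.intervalIntegrable) 0
  set q : ℝ → ℝ := fun x => ∫ s in (0 : ℝ)..x, P s with hq
  have dq : ∀ x, HasDerivAt q (P x) x := hasDerivAt_integral_of_continuous cP
  have cq : Continuous q := continuous_iff_continuousAt.2 fun x => (dq x).continuousAt
  have q0 : q 0 = 0 := by simp [hq]
  -- The second derivative is sought as `y + q` with `q'' = g` a.e.; this leaves `y'' = m² (y + q)`,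
  -- whose datum is continuous. The value `-q L` makes `y + q` vanish at `L`.
  obtain ⟨y, y', y0, yL, dy, dy'⟩ := exists_solution_second_order hL hm cq (-q L)
  have cy : Continuous y := continuous_iff_continuousAt.2 fun x => (dy x).continuousAt
  set V : ℝ → ℝ := fun x => ∫ s in (0 : ℝ)..x, (y s + q s)
  have dV : ∀ x, HasDerivAt V (y x + q x) x := hasDerivAt_integral_of_continuous (cy.add cq)
  have cV : Continuous V := continuous_iff_continuousAt.2 fun x => (dV x).continuousAt
  set U : ℝ → ℝ := fun x => ∫ s in (0 : ℝ)..x, V s with hU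
  have dU : ∀ x, HasDerivAt U (V x) x := hasDerivAt_integral_of_continuous cV
  have U0 : U 0 = 0 := by simp [hU]
  have aP : AbsolutelyContinuousOnInterval P 0 L :=
    ig'.intervalIntegrable.absolutelyContinuousOnInterval_intervalIntegral (by simp)
  have ay' : AbsolutelyContinuousOnInterval y' 0 L :=
    absolutelyContinuousOnInterval_of_hasDerivWithinAt hL
      (fun x _ => (dy' x).hasDerivWithinAt) (by fun_prop)
  -- The linear correction achieves `w L = 0` without changing `w''`.
  obtain ⟨h1, h2, h3⟩ := memW41_of_hasDerivWithinAt hL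
    (w₀ := fun x => U x - U L / L * x) (w₁ := fun x => V x - U L / L) (w₂ := fun x => y x + q x)
    (w₃ := fun x => y' x + P x)
    (fun x _ => by
      have := (dU x).sub ((hasDerivAt_id x).const_mul (U L / L))
      convert! this.hasDerivWithinAt using 1
      simp)
    (fun x _ => ((dV x).sub_const _).hasDerivWithinAt)
    (fun x _ => ((dy x).add (dq x)).hasDerivWithinAt)
    (ay'.fun_add aP)
  refine ⟨_, h1, ⟨?_, ?_, ?_, ?_⟩, ?_⟩
  · simp [U0]
  · field_simp; ring
  · simp [h2 (left_mem_Icc.2 hL.le), y0, q0]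
  · simp [h2 (right_mem_Icc.2 hL.le), yL]
  · filter_upwards [ig'.intervalIntegrable.ae_hasDerivAt_integral (a := 0) (b := L)] with x hx hmem
    have dP : HasDerivAt P (g' x) x :=
      hx (by rw [uIcc_of_le hL.le]; exact Ioo_subset_Icc_self hmem) 0 (by simp)
    rw [D_four_eq_of_eqOn h3 hmem ((dy' x).add dP), h2 (Ioo_subset_Icc_self hmem), hg',
      indicator_of_mem (Ioo_subset_Ioc_self hmem)]
    ring

/-- Solvability of `G w = g` with hinged ends, for integrable `g`. -/
theorem exists_G_solution (hL : 0 < L) (hm : 0 < m) {N : ℝ} (hN : 0 < N)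
    (hA : Admissible L m N) {g : ℝ → ℝ} (hg : IntervalIntegrable g volume 0 L) :
    ∃ w, MemW41 L w ∧ Hinged L w ∧ ∀ᵐ x, x ∈ Ioo 0 L → G L (m ^ 2) N w x = g x := by
  obtain ⟨v, v1, v2, v3⟩ := exists_hinged_solution hL hm hg
  obtain ⟨p1, p2, p3, p4⟩ := memW41_unitLoad hL hm
  have hK := hA.one_add_pos hL hm hN
  -- `I` solves the consistency equation `∫ (v - N I ψ) = I`.
  set I := (∫ s in (0 : ℝ)..L, v s) / (1 + N * unitLoadIntegral L m) with hI
  obtain ⟨q1, q2, q3⟩ := v1.linearCombination hL p1 1 (-(N * I))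
  have q5 := integral_linearCombination hL v1 p1 1 (-(N * I))
  rw [integral_unitLoad hL hm] at q5
  have e : (∫ s in (0 : ℝ)..L, v s) = I * (1 + N * unitLoadIntegral L m) := by
    rw [hI]; field_simp
  refine ⟨_, q1, v2.linearCombination hL v1 p1 p2 1 (-(N * I)), ?_⟩
  filter_upwards [v3, q3] with x hx hx3 hmem
  unfold G
  rw [hx3 hmem, q2 x (Ioo_subset_Icc_self hmem), q5, e, ← hx hmem]
  linear_combination (-(N * I)) * p4 x hmem

/-- A priori bound for `w''` in terms of `w'''' - m² w''`. -/
theorem abs_D_two_le (hL : 0 < L) (hm : 0 < m) (hw : MemW41 L w) (hw' : Hinged L w) {x : ℝ}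
    (hx : x ∈ Icc 0 L) :
    |D L 2 w x| ≤ Real.sinh (m * L) / m *
      ∫ s in (0 : ℝ)..L, |D L 4 w s - m ^ 2 * D L 2 w s| := by
  set H : ℝ → ℝ := fun s => D L 4 w s - m ^ 2 * D L 2 w s with hH
  have iH : IntervalIntegrable H volume 0 L := intervalIntegrable_source hL hw
  have s0 : uIcc 0 x ⊆ uIcc 0 L := by
    rw [uIcc_of_le hx.1, uIcc_of_le hL.le]; exact Icc_subset_Icc le_rfl hx.2
  have s1 : uIcc x L ⊆ uIcc 0 L := by
    rw [uIcc_of_le hx.2, uIcc_of_le hL.le]; exact Icc_subset_Icc hx.1 le_rfl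
  have rep := green_representation (m := m) hL hw hw'.2.2.1 hw'.2.2.2 hx
  have bound : ∀ {a b : ℝ} {κ : ℝ → ℝ}, a ≤ b → IntervalIntegrable H volume a b →
      (∀ s ∈ Icc a b, |κ s| ≤ Real.sinh (m * L)) →
      |∫ s in a..b, κ s * H s| ≤ Real.sinh (m * L) * ∫ s in a..b, |H s| := by
    intro a b κ hab iab hκ
    rw [← intervalIntegral.integral_const_mul]
    have := intervalIntegral.norm_integral_le_of_norm_le (f := fun s => κ s * H s)
      (g := fun s => Real.sinh (m * L) * |H s|) hab
      (ae_of_all _ fun s hs => by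
        rw [Real.norm_eq_abs, abs_mul]
        exact mul_le_mul_of_nonneg_right (hκ s (Ioc_subset_Icc_self hs)) (abs_nonneg _))
      (iab.abs.const_mul _)
    simpa using this
  have hsinh : ∀ s ∈ Icc 0 L, 0 ≤ Real.sinh (m * s) ∧ Real.sinh (m * s) ≤ Real.sinh (m * L) :=
    fun s hs => ⟨Real.sinh_nonneg_iff.2 (mul_nonneg hm.le hs.1),
      Real.sinh_le_sinh.2 (mul_le_mul_of_nonneg_left hs.2 hm.le)⟩
  have hsymm : ∀ s ∈ Icc 0 L, L - s ∈ Icc 0 L := fun s hs =>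
    ⟨sub_nonneg.2 hs.2, by linarith [hs.1]⟩
  have bA := bound (κ := fun s => Real.sinh (m * s)) hx.1 (iH.mono_set s0) fun s hs => by
    have := hsinh s ⟨hs.1, hs.2.trans hx.2⟩
    rw [abs_of_nonneg this.1]; exact this.2
  have bB := bound (κ := fun s => Real.sinh (m * (L - s))) hx.2 (iH.mono_set s1) fun s hs => by
    have := hsinh (L - s) (hsymm s ⟨hx.1.trans hs.1, hs.2⟩)
    rw [abs_of_nonneg this.1]; exact this.2
  rw [← intervalIntegral.integral_add_adjacent_intervals (iH.mono_set s0).abs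
    (iH.mono_set s1).abs]
  set A := ∫ s in (0 : ℝ)..x, Real.sinh (m * s) * H s
  set B := ∫ s in x..L, Real.sinh (m * (L - s)) * H s
  have hst : 0 < Real.sinh (m * L) := Real.sinh_pos_iff.2 (mul_pos hm hL)
  obtain ⟨a1, a2⟩ := hsinh x hx
  obtain ⟨b1, b2⟩ := hsinh (L - x) (hsymm x hx)
  have key : m * Real.sinh (m * L) * |D L 2 w x| ≤ Real.sinh (m * L) * |A| +
      Real.sinh (m * L) * |B| := by
    have : m * Real.sinh (m * L) * |D L 2 w x| = |m * Real.sinh (m * L) * (-D L 2 w x)| := by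
      rw [abs_mul, abs_neg, abs_of_pos (mul_pos hm hst)]
    rw [this, rep]
    refine (abs_add_le _ _).trans ?_
    rw [abs_mul, abs_mul, abs_of_nonneg a1, abs_of_nonneg b1]
    gcongr
  have key2 : m * |D L 2 w x| ≤ |A| + |B| := by
    refine le_of_mul_le_mul_left ?_ hst
    linarith
  rw [div_mul_eq_mul_div, le_div_iff₀ hm]
  linarith

/-- A priori bound for `w` in terms of `w''`. -/
theorem abs_le_of_abs_D_two_le (hL : 0 < L) (hw : MemW41 L w) (hw' : Hinged L w) {K : ℝ}
    (hK : ∀ x ∈ Icc 0 L, |D L 2 w x| ≤ K) {x : ℝ} (hx : x ∈ Icc 0 L) : |w x| ≤ K * L * L := by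
  have hK0 : 0 ≤ K := (abs_nonneg _).trans (hK x hx)
  -- Rolle's theorem gives a zero of `w'`, the base point for bounding `w'`; then `w` is bounded
  -- from `w 0 = 0`.
  obtain ⟨ξ, hξ, hξ0⟩ := exists_hasDerivAt_eq_zero (f := w) (f' := D L 1 w) hL
    (by simpa using hw.continuousOn hL (k := 0) (by norm_num)) (by rw [hw'.1, hw'.2.1])
    fun y hy => by simpa using hw.hasDerivAt hL (k := 0) (by norm_num) hy
  have h1 : ∀ y ∈ Icc 0 L, ‖D L 1 w y‖ ≤ K * L := by
    intro y hy
    have := (convex_Icc 0 L).norm_image_sub_le_of_norm_hasDerivWithin_le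
      (fun y hy => hw.hasDerivWithinAt hL (k := 1) (by norm_num) hy)
      (fun y hy => hK y hy) (Ioo_subset_Icc_self hξ) hy
    rw [hξ0, sub_zero] at this
    refine this.trans (mul_le_mul_of_nonneg_left ?_ hK0)
    rw [Real.norm_eq_abs, abs_le]
    constructor <;> linarith [hy.1, hy.2, hξ.1, hξ.2]
  have := (convex_Icc 0 L).norm_image_sub_le_of_norm_hasDerivWithin_le (f := w)
      (fun y hy => by simpa using hw.hasDerivWithinAt hL (k := 0) (by norm_num) hy)
      h1 (left_mem_Icc.2 hL.le) hx
  rw [hw'.1, sub_zero] at this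
  refine this.trans (mul_le_mul_of_nonneg_left ?_ (mul_nonneg hK0 hL.le))
  rw [sub_zero, Real.norm_eq_abs, abs_of_nonneg hx.1]
  exact hx.2

end Melan

/-! ### The iteration: monotonicity, uniqueness and passage to the limit -/

namespace Melan

variable {L a b c m N : ℝ} {p u v w : ℝ → ℝ}

theorem Precedes.refl (L : ℝ) (u : ℝ → ℝ) : Precedes L u u := fun _ _ => ⟨le_rfl, le_rfl⟩

theorem Precedes.trans (h : Precedes L u v) (h' : Precedes L v w) : Precedes L u w :=
  fun x hx => ⟨(h x hx).1.trans (h' x hx).1, (h' x hx).2.trans (h x hx).2⟩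

theorem MemW41.intervalIntegrable_self (hL : 0 < L) (hu : MemW41 L u) :
    IntervalIntegrable u volume 0 L := by
  simpa using hu.intervalIntegrable hL (k := 0) (by norm_num)

theorem Precedes.integral_le (hL : 0 < L) (hu : MemW41 L u) (hv : MemW41 L v)
    (h : Precedes L u v) : ∫ x in (0 : ℝ)..L, u x ≤ ∫ x in (0 : ℝ)..L, v x :=
  intervalIntegral.integral_mono_on hL.le (hu.intervalIntegrable_self hL)
    (hv.intervalIntegrable_self hL) fun x hx => (h x hx).1

theorem exists_isStep (hL : 0 < L) (hm : 0 < m) (hN : 0 < N) (hA : Admissible L m N)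
    (hp : IntervalIntegrable p volume 0 L) (hu : MemW41 L u) :
    ∃ v, IsStep L a b c (m ^ 2) N p u v := by
  apply exists_G_solution hL hm hN hA
  have i2 := hu.intervalIntegrable hL (k := 2) (by norm_num)
  unfold f
  exact ((((hp.add (i2.const_mul a)).add ((i2.const_mul b).mul_const _)).sub
    intervalIntegrable_const).sub (i2.const_mul _)).add intervalIntegrable_const

theorem exists_isIteration (hL : 0 < L) (hm : 0 < m) (hN : 0 < N) (hA : Admissible L m N)
    (hp : IntervalIntegrable p volume 0 L) (hu : MemW41 L u) :
    ∃ y, IsIteration L a b c (m ^ 2) N p u y := by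
  -- The subtype carries the regularity that keeps the next right-hand side integrable.
  have : ∀ s : {w // MemW41 L w}, ∃ t : {w // MemW41 L w},
      IsStep L a b c (m ^ 2) N p s.1 t.1 := fun s => by
    obtain ⟨v, hv⟩ := exists_isStep (a := a) (b := b) (c := c) hL hm hN hA hp s.2
    exact ⟨⟨v, hv.1⟩, hv⟩
  choose T hT using this
  refine ⟨fun n => (T^[n] ⟨u, hu⟩).1, rfl, fun n => ?_⟩
  simp only [Function.iterate_succ_apply']
  exact hT _

/-- Monotonicity of the iteration step below an upper bound `w`. -/
theorem IsStep.precedes (hL : 0 < L) (hm : 0 < m) (hN : 0 < N) (hA : Admissible L m N)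
    (hb : 0 < b) (hw : MemW41 L w) (hwM : a + b * (∫ x in (0 : ℝ)..L, w x) ≤ m ^ 2)
    (hwN : ∀ x ∈ Icc 0 L, c - b * D L 2 w x ≤ N) (hu : MemW41 L u) (hv : MemW41 L v)
    (huv : Precedes L u v) (hvw : Precedes L v w) {u' v' : ℝ → ℝ}
    (su : IsStep L a b c (m ^ 2) N p u u') (sv : IsStep L a b c (m ^ 2) N p v v') :
    Precedes L u' v' := by
  apply precedes_of_G_le hL hm hN hA su.1 su.2.1 sv.1 sv.2.1
  filter_upwards [su.2.2, sv.2.2] with x hxu hxv hmem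
  have hx := Ioo_subset_Icc_self hmem
  rw [hxu hmem, hxv hmem]
  unfold f
  have i1 := huv.integral_le hL hu hv
  have i2 := hvw.integral_le hL hv hw
  have d1 := (huv x hx).2
  have d2 := (hvw x hx).2
  have d3 := hwN x hx
  -- The right-hand sides for `v` and `u` differ by the sum of the products in `k1` and `k2`; the
  -- bounds on `w` pass to `∫ v` and to `u''`.
  have k1 : 0 ≤ (m ^ 2 - a - b * ∫ x in (0 : ℝ)..L, v x) * (D L 2 u x - D L 2 v x) :=
    mul_nonneg (by nlinarith) (by linarith)
  have k2 : 0 ≤ (N - c + b * D L 2 u x) *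
      ((∫ x in (0 : ℝ)..L, v x) - ∫ x in (0 : ℝ)..L, u x) :=
    mul_nonneg (by nlinarith) (by linarith)
  nlinarith

theorem IsLowerSolution.precedes_step (hL : 0 < L) (hm : 0 < m) (hN : 0 < N)
    (hA : Admissible L m N) (hu : IsLowerSolution L a b c p u)
    (su : IsStep L a b c (m ^ 2) N p u v) : Precedes L u v := by
  apply precedes_of_G_le hL hm hN hA hu.1 hu.2.1 su.1 su.2.1
  filter_upwards [su.2.2, hu.2.2] with x h1 h2 hmem
  have h3 := h2 hmem
  rw [h1 hmem]
  unfold melanLHS at h3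
  unfold f G
  linarith

theorem IsUpperSolution.step_precedes (hL : 0 < L) (hm : 0 < m) (hN : 0 < N)
    (hA : Admissible L m N) (hu : IsUpperSolution L a b c p u)
    (su : IsStep L a b c (m ^ 2) N p u v) : Precedes L v u := by
  apply precedes_of_G_le hL hm hN hA su.1 su.2.1 hu.1 hu.2.1
  filter_upwards [su.2.2, hu.2.2] with x h1 h2 hmem
  have h3 := h2 hmem
  rw [h1 hmem]
  unfold melanLHS at h3
  unfold f G
  linarith

/-- The terms added in `M` and `N` cancel, so solutions are fixed points of the step and can be
compared with the iterates. -/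
theorem IsSolution.isStep (hu : IsSolution L a b c p u) (M : ℝ) :
    IsStep L a b c M N p u u := by
  refine ⟨hu.1, hu.2.1, ?_⟩
  filter_upwards [hu.2.2] with x h2 hmem
  have h3 := h2 hmem
  unfold melanLHS at h3
  unfold f G
  linarith

theorem IsIteration.memW41 {M : ℝ} {y : ℕ → ℝ → ℝ} (hu : MemW41 L u)
    (hy : IsIteration L a b c M N p u y) (n : ℕ) : MemW41 L (y n) := by
  cases n with
  | zero => rw [hy.1]; exact hu
  | succ n => exact (hy.2 n).1

/-- Needed for uniqueness: the iterates are determined on `[0, L]` only, with arbitrary values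
outside. -/
theorem IsStep.congr {M : ℝ} {u' : ℝ → ℝ} (hL : 0 < L) (h : EqOn u u' (Icc 0 L))
    (hu : IsStep L a b c M N p u v) : IsStep L a b c M N p u' v := by
  have e : ∫ x in (0 : ℝ)..L, u x = ∫ x in (0 : ℝ)..L, u' x :=
    intervalIntegral.integral_congr (by rwa [uIcc_of_le hL.le])
  refine ⟨hu.1, hu.2.1, ?_⟩
  filter_upwards [hu.2.2] with x hx hmem
  rw [hx hmem, e, D_congr h 2 (Ioo_subset_Icc_self hmem)]

theorem IsIteration.eqOn (hL : 0 < L) (hm : 0 < m) (hN : 0 < N) (hA : Admissible L m N)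
    {y z : ℕ → ℝ → ℝ} (hy : IsIteration L a b c (m ^ 2) N p u y)
    (hz : IsIteration L a b c (m ^ 2) N p u z) (n : ℕ) : EqOn (z n) (y n) (Icc 0 L) := by
  induction n with
  | zero => rw [hy.1, hz.1]; exact fun _ _ => rfl
  | succ n ih =>
    have s1 := hy.2 n
    have s2 := (hz.2 n).congr hL ih
    have h12 := precedes_of_G_le hL hm hN hA s1.1 s1.2.1 s2.1 s2.2.1 (by
      filter_upwards [s1.2.2, s2.2.2] with x h1 h2 hmem
      rw [h1 hmem, h2 hmem])
    have h21 := precedes_of_G_le hL hm hN hA s2.1 s2.2.1 s1.1 s1.2.1 (by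
      filter_upwards [s1.2.2, s2.2.2] with x h1 h2 hmem
      rw [h1 hmem, h2 hmem])
    exact fun x hx => le_antisymm (h21 x hx).1 (h12 x hx).1

/-- Monotonicity of the iterations started at a lower and an upper solution. -/
theorem iteration_monotone (hL : 0 < L) (hm : 0 < m) (hN : 0 < N) (hA : Admissible L m N)
    (hb : 0 < b) {α β : ℝ → ℝ} (hα : IsLowerSolution L a b c p α)
    (hβ : IsUpperSolution L a b c p β) (hαβ : Precedes L α β)
    (hβM : a + b * (∫ x in (0 : ℝ)..L, β x) ≤ m ^ 2)
    (hβN : ∀ x ∈ Icc 0 L, c - b * D L 2 β x ≤ N) {A B : ℕ → ℝ → ℝ}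
    (iA : IsIteration L a b c (m ^ 2) N p α A) (iB : IsIteration L a b c (m ^ 2) N p β B) (n : ℕ) :
    Precedes L (A n) (A (n + 1)) ∧ Precedes L (A n) (B n) ∧ Precedes L (B (n + 1)) (B n) ∧
      Precedes L (B n) β := by
  have mA := iA.memW41 hα.1
  have mB := iB.memW41 hβ.1
  -- The upper sequence is treated first: its bound by `β` is what allows `IsStep.precedes` to be
  -- applied to the lower one.
  have hB : ∀ n, Precedes L (B (n + 1)) (B n) ∧ Precedes L (B n) β := by
    intro n
    induction n with
    | zero =>
      have := iB.2 0
      rw [iB.1] at this ⊢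
      exact ⟨hβ.step_precedes hL hm hN hA this, Precedes.refl L β⟩
    | succ n ih =>
      exact ⟨(iB.2 (n + 1)).precedes hL hm hN hA hb hβ.1 hβM hβN (mB _) (mB _) ih.1 ih.2 (iB.2 n),
        ih.1.trans ih.2⟩
  have hAB : ∀ n, Precedes L (A n) (B n) := by
    intro n
    induction n with
    | zero => rw [iA.1, iB.1]; exact hαβ
    | succ n ih =>
      exact (iA.2 n).precedes hL hm hN hA hb hβ.1 hβM hβN (mA _) (mB _) ih (hB n).2 (iB.2 n)
  refine ⟨?_, hAB n, (hB n).1, (hB n).2⟩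
  induction n with
  | zero =>
    have := iA.2 0
    rw [iA.1] at this ⊢
    exact hα.precedes_step hL hm hN hA this
  | succ n ih =>
    exact (iA.2 n).precedes hL hm hN hA hb hβ.1 hβM hβN (mA _) (mA _) ih
      ((hAB (n + 1)).trans (hB (n + 1)).2) (iA.2 (n + 1))

/-- A bounded iteration whose second derivatives converge pointwise and whose integrals converge
tends uniformly to a solution. -/
theorem IsIteration.exists_limit (hL : 0 < L) (hm : 0 < m)
    (hp : IntervalIntegrable p volume 0 L) (hu : MemW41 L u) {y : ℕ → ℝ → ℝ}
    (hy : IsIteration L a b c (m ^ 2) N p u y) {K I : ℝ} {ζ : ℝ → ℝ}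
    (hK : ∀ n, ∀ x ∈ Icc 0 L, |D L 2 (y n) x| ≤ K)
    (hζ : ∀ x ∈ Icc 0 L, Tendsto (fun n => D L 2 (y n) x) atTop (𝓝 (ζ x)))
    (hI : Tendsto (fun n => ∫ x in (0 : ℝ)..L, y n x) atTop (𝓝 I)) :
    ∃ v, IsSolution L a b c p v ∧ EqOn (D L 2 v) ζ (Icc 0 L) ∧
      TendstoUniformlyOn y v atTop (Icc 0 L) := by
  have my := hy.memW41 hu
  set J : ℕ → ℝ := fun n => ∫ x in (0 : ℝ)..L, y n x with hJ
  have hIoc : uIoc 0 L = Ioc 0 L := uIoc_of_le hL.le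
  have i2 : ∀ n, IntervalIntegrable (D L 2 (y n)) volume 0 L := fun n =>
    (my n).intervalIntegrable hL (by norm_num)
  have mζ : AEStronglyMeasurable ζ (volume.restrict (uIoc 0 L)) := by
    refine aestronglyMeasurable_of_tendsto_ae atTop (f := fun n => D L 2 (y n))
      (fun n => (i2 n).aestronglyMeasurable_restrict_uIoc) ?_
    rw [ae_restrict_iff' measurableSet_uIoc, hIoc]
    exact ae_of_all _ fun x hx => hζ x (Ioc_subset_Icc_self hx)
  have bζ : ∀ x ∈ Icc 0 L, |ζ x| ≤ K := fun x hx =>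
    le_of_tendsto' (hζ x hx).abs fun n => hK n x hx
  have iζ : IntervalIntegrable ζ volume 0 L := by
    refine (intervalIntegrable_const (c := K)).mono_fun mζ ?_
    rw [EventuallyLE, ae_restrict_iff' measurableSet_uIoc, hIoc]
    refine ae_of_all _ fun x hx => ?_
    rw [Real.norm_eq_abs, Real.norm_eq_abs]
    exact (bζ x (Ioc_subset_Icc_self hx)).trans (le_abs_self K)
  -- The candidate limit solves the linear equation whose source is the formal limit of the
  -- iteration, with the `N` terms cancelled.
  obtain ⟨v, v1, v2, v3⟩ := exists_hinged_solution hL hm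
    (g := fun x => p x + (a + b * I - m ^ 2) * ζ x - c * I)
    ((hp.add (iζ.const_mul _)).sub intervalIntegrable_const)
  set A : ℕ → ℝ := fun n => a + b * J n - m ^ 2 with hAdef
  set R : ℕ → ℝ := fun n => (N - c) * J n - N * J (n + 1) + c * I with hRdef
  -- `η n` is the source `z'''' - m² z''` of the error `z = y (n + 1) - v`; it tends to `0`
  -- pointwise and boundedly, hence in `L¹`.
  set η : ℕ → ℝ → ℝ := fun n x => A n * D L 2 (y n) x - (a + b * I - m ^ 2) * ζ x + R n with hη
  have tA : Tendsto A atTop (𝓝 (a + b * I - m ^ 2)) :=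
    ((hI.const_mul b).const_add a).sub_const _
  have tR : Tendsto R atTop (𝓝 0) := by
    have := ((hI.const_mul (N - c)).sub
      (((tendsto_add_atTop_iff_nat 1).2 hI).const_mul N)).add_const (c * I)
    convert this using 2
    ring
  obtain ⟨CA, hCA⟩ := (Metric.isBounded_range_of_tendsto _ tA).exists_norm_le
  obtain ⟨CR, hCR⟩ := (Metric.isBounded_range_of_tendsto _ tR).exists_norm_le
  replace hCA : ∀ n, |A n| ≤ CA := fun n => hCA _ (mem_range_self n)
  replace hCR : ∀ n, |R n| ≤ CR := fun n => hCR _ (mem_range_self n)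
  have tη : Tendsto (fun n => ∫ x in (0 : ℝ)..L, |η n x|) atTop (𝓝 0) := by
    have := intervalIntegral.tendsto_integral_filter_of_dominated_convergence (a := 0) (b := L)
      (μ := volume) (l := atTop) (F := fun n x => |η n x|) (f := fun _ => (0 : ℝ))
      (fun _ => CA * K + |a + b * I - m ^ 2| * K + CR)
      (Eventually.of_forall fun n => by
        have := ((((i2 n).const_mul (A n)).sub (iζ.const_mul (a + b * I - m ^ 2))).add
          (intervalIntegrable_const (c := R n))).abs
        exact this.aestronglyMeasurable_restrict_uIoc)
      (Eventually.of_forall fun n => ae_of_all _ fun x hx => by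
        rw [hIoc] at hx
        have hx' := Ioc_subset_Icc_self hx
        rw [Real.norm_eq_abs, abs_abs]
        calc |η n x| ≤ |A n * D L 2 (y n) x| + |(a + b * I - m ^ 2) * ζ x| + |R n| :=
              (abs_add_le _ _).trans (add_le_add_left (abs_sub _ _) _)
          _ ≤ _ := by
              rw [abs_mul, abs_mul]
              have hCA0 : 0 ≤ CA := (abs_nonneg _).trans (hCA n)
              gcongr
              · exact hCA n
              · exact hK n x hx'
              · exact bζ x hx'
              · exact hCR n)
      intervalIntegrable_const
      (ae_of_all _ fun x hx => by
        rw [hIoc] at hx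
        have := (((tA.mul (hζ x (Ioc_subset_Icc_self hx))).sub_const
          ((a + b * I - m ^ 2) * ζ x)).add tR).abs
        simpa using this)
    simpa using this
  set ε : ℕ → ℝ := fun n => Real.sinh (m * L) / m * ∫ x in (0 : ℝ)..L, |η n x| with hε
  have tε : Tendsto ε atTop (𝓝 0) := by simpa using tη.const_mul (Real.sinh (m * L) / m)
  have est : ∀ n, ∀ x ∈ Icc 0 L, |D L 2 (y (n + 1)) x - D L 2 v x| ≤ ε n ∧
      |y (n + 1) x - v x| ≤ ε n * L * L := by
    intro n
    obtain ⟨q1, q2, q3⟩ := (my (n + 1)).linearCombination hL v1 1 (-1)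
    have q4 := (hy.2 n).2.1.linearCombination hL (my (n + 1)) v1 v2 1 (-1)
    have hne : ∀ᵐ s : ℝ, s ≠ L := by simp [ae_iff, measure_singleton]
    have e : ∫ s in (0 : ℝ)..L, |D L 4 (fun x => 1 * y (n + 1) x + -1 * v x) s -
        m ^ 2 * D L 2 (fun x => 1 * y (n + 1) x + -1 * v x) s| = ∫ x in (0 : ℝ)..L, |η n x| := by
      apply intervalIntegral.integral_congr_ae
      filter_upwards [q3, v3, (hy.2 n).2.2, hne] with s h3 hv hs hsL hmem
      rw [hIoc] at hmem
      have hmem' : s ∈ Ioo 0 L := ⟨hmem.1, lt_of_le_of_ne hmem.2 hsL⟩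
      have h1 := hs hmem'
      have h2 := hv hmem'
      unfold G f at h1
      rw [h3 hmem', q2 s (Ioo_subset_Icc_self hmem')]
      congr 1
      simp only [hη, hAdef, hRdef, hJ]
      linear_combination h1 - h2
    have bd : ∀ x ∈ Icc 0 L, |D L 2 (fun x => 1 * y (n + 1) x + -1 * v x) x| ≤ ε n := by
      intro x hx
      have := abs_D_two_le hL hm q1 q4 hx
      rwa [e] at this
    intro x hx
    refine ⟨?_, ?_⟩
    · have := bd x hx
      rw [q2 x hx] at this
      convert this using 2; ring
    · have := abs_le_of_abs_D_two_le hL q1 q4 bd hx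
      convert this using 2; ring
  -- Uniqueness of limits identifies `ζ` with `v''`, and then `I` with `∫ v`, which turns the linear
  -- equation for `v` into the Melan equation.
  have eζ : EqOn (D L 2 v) ζ (Icc 0 L) := by
    intro x hx
    have h1 : Tendsto (fun n => D L 2 (y (n + 1)) x) atTop (𝓝 (D L 2 v x)) := by
      rw [tendsto_iff_dist_tendsto_zero]
      exact squeeze_zero (fun n => dist_nonneg) (fun n => (est n x hx).1) tε
    exact tendsto_nhds_unique h1 ((tendsto_add_atTop_iff_nat 1).2 (hζ x hx))
  have eI : ∫ x in (0 : ℝ)..L, v x = I := by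
    have h1 : Tendsto (fun n => J (n + 1)) atTop (𝓝 (∫ x in (0 : ℝ)..L, v x)) := by
      rw [tendsto_iff_dist_tendsto_zero]
      refine squeeze_zero (fun n => dist_nonneg) (g := fun n => ε n * L * L * L) (fun n => ?_)
        (by simpa using ((tε.mul_const L).mul_const L).mul_const L)
      rw [Real.dist_eq, hJ, ← intervalIntegral.integral_sub ((my _).intervalIntegrable_self hL)
        (v1.intervalIntegrable_self hL)]
      have := intervalIntegral.norm_integral_le_of_norm_le_const (a := 0) (b := L)
        (f := fun x => y (n + 1) x - v x) (C := ε n * L * L) fun x hx => by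
          rw [hIoc] at hx
          exact (est n x (Ioc_subset_Icc_self hx)).2
      simpa [abs_of_pos hL] using this
    exact tendsto_nhds_unique h1 ((tendsto_add_atTop_iff_nat 1).2 hI)
  refine ⟨v, ⟨v1, v2, ?_⟩, eζ, ?_⟩
  · filter_upwards [v3] with x hx hmem
    have h1 := hx hmem
    unfold melanLHS
    rw [eI]
    rw [← eζ (Ioo_subset_Icc_self hmem)] at h1
    linear_combination h1
  · rw [Metric.tendstoUniformlyOn_iff]
    intro δ hδ
    have t : Tendsto (fun n => ε n * L * L) atTop (𝓝 0) := by
      simpa using (tε.mul_const L).mul_const L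
    obtain ⟨n₀, h₀⟩ := eventually_atTop.1 (t.eventually (gt_mem_nhds hδ))
    refine eventually_atTop.2 ⟨n₀ + 1, fun n hn x hx => ?_⟩
    obtain ⟨k, rfl⟩ : ∃ k, n = k + 1 := ⟨n - 1, by omega⟩
    rw [dist_comm]
    exact (est k x hx).2.trans_lt (h₀ k (by omega))

end Melan

/-! ### Convergence of monotone iterations in a sector -/

namespace Melan

variable {L a b c m N : ℝ} {p u v : ℝ → ℝ}

theorem exists_tendsto_of_monotone_or_antitone {s : ℕ → ℝ} {l r : ℝ} (hl : ∀ n, l ≤ s n)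
    (hr : ∀ n, s n ≤ r) (h : (∀ n, s n ≤ s (n + 1)) ∨ ∀ n, s (n + 1) ≤ s n) :
    ∃ t, Tendsto s atTop (𝓝 t) := by
  rcases h with h | h
  · exact ⟨_, tendsto_atTop_ciSup (monotone_nat_of_le_succ h) ⟨r, by rintro _ ⟨n, rfl⟩; exact hr n⟩⟩
  · exact ⟨_, tendsto_atTop_ciInf (antitone_nat_of_succ_le h) ⟨l, by rintro _ ⟨n, rfl⟩; exact hl n⟩⟩

/-- An iteration that is monotone for `Precedes` and stays in a sector converges to a solution. -/
theorem IsIteration.exists_limit_of_precedes (hL : 0 < L) (hm : 0 < m)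
    (hp : IntervalIntegrable p volume 0 L) (hu : MemW41 L u) {y : ℕ → ℝ → ℝ}
    (hy : IsIteration L a b c (m ^ 2) N p u y) {α β : ℝ → ℝ} (hα : MemW41 L α) (hβ : MemW41 L β)
    (hlo : ∀ n, Precedes L α (y n)) (hhi : ∀ n, Precedes L (y n) β)
    (h : (∀ n, Precedes L (y n) (y (n + 1))) ∨ ∀ n, Precedes L (y (n + 1)) (y n)) :
    ∃ v, IsSolution L a b c p v ∧
      (∀ x ∈ Icc 0 L, Tendsto (fun n => D L 2 (y n) x) atTop (𝓝 (D L 2 v x))) ∧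
      TendstoUniformlyOn y v atTop (Icc 0 L) := by
  have my := hy.memW41 hu
  have hζ : ∀ x, ∃ t, x ∈ Icc 0 L → Tendsto (fun n => D L 2 (y n) x) atTop (𝓝 t) := by
    intro x
    by_cases hx : x ∈ Icc 0 L
    -- `Precedes` reverses the order of second derivatives, hence the swapped alternatives in
    -- `h.symm`.
    · obtain ⟨t, ht⟩ := exists_tendsto_of_monotone_or_antitone
        (s := fun n => D L 2 (y n) x) (fun n => (hhi n x hx).2) (fun n => (hlo n x hx).2)
        (h.symm.imp (fun h n => (h n x hx).2) fun h n => (h n x hx).2)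
      exact ⟨t, fun _ => ht⟩
    · exact ⟨0, fun h => absurd h hx⟩
  choose ζ hζ using hζ
  obtain ⟨I, hI⟩ := exists_tendsto_of_monotone_or_antitone
    (s := fun n => ∫ x in (0 : ℝ)..L, y n x)
    (fun n => (hlo n).integral_le hL hα (my n)) (fun n => (hhi n).integral_le hL (my n) hβ)
    (h.imp (fun h n => (h n).integral_le hL (my n) (my (n + 1)))
      fun h n => (h n).integral_le hL (my (n + 1)) (my n))
  obtain ⟨Kα, hKα⟩ := isCompact_Icc.exists_bound_of_continuousOn
    (hα.continuousOn hL (k := 2) (by norm_num))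
  obtain ⟨Kβ, hKβ⟩ := isCompact_Icc.exists_bound_of_continuousOn
    (hβ.continuousOn hL (k := 2) (by norm_num))
  obtain ⟨v, hv, e, t⟩ := hy.exists_limit hL hm hp hu (K := max Kα Kβ) (fun n x hx => by
    have h1 := (abs_le.1 (hKα x hx)).2
    have h2 := (abs_le.1 (hKβ x hx)).1
    rw [abs_le]
    constructor
    · linarith [(hhi n x hx).2, le_max_right Kα Kβ]
    · linarith [(hlo n x hx).2, le_max_left Kα Kβ]) hζ hI
  exact ⟨v, hv, fun x hx => by rw [e hx]; exact hζ x hx, t⟩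

theorem precedes_of_tendsto_left {y : ℕ → ℝ → ℝ}
    (h2 : ∀ x ∈ Icc 0 L, Tendsto (fun n => D L 2 (y n) x) atTop (𝓝 (D L 2 v x)))
    (h0 : TendstoUniformlyOn y v atTop (Icc 0 L)) (h : ∀ n, Precedes L (y n) u) :
    Precedes L v u := fun x hx =>
  ⟨le_of_tendsto' (h0.tendsto_at hx) fun n => (h n x hx).1,
    ge_of_tendsto' (h2 x hx) fun n => (h n x hx).2⟩

theorem precedes_of_tendsto_right {y : ℕ → ℝ → ℝ}
    (h2 : ∀ x ∈ Icc 0 L, Tendsto (fun n => D L 2 (y n) x) atTop (𝓝 (D L 2 v x)))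
    (h0 : TendstoUniformlyOn y v atTop (Icc 0 L)) (h : ∀ n, Precedes L u (y n)) :
    Precedes L u v := fun x hx =>
  ⟨ge_of_tendsto' (h0.tendsto_at hx) fun n => (h n x hx).1,
    le_of_tendsto' (h2 x hx) fun n => (h n x hx).2⟩

end Melan

/-! ### Extremal solutions of the Melan problem -/

theorem theorem4p1 (L a b c M N : ℝ) (hL : 0 < L) (ha : 0 < a) (hb : 0 < b) (hc : 0 < c)
    (p : ℝ → ℝ) (hp : IntervalIntegrable p volume 0 L)
    (hM : 0 < M) (hN : 0 < N)
    (hMN : N ≤ 4 * M / L ^ 3 * Melan.σ (Real.sqrt M * L))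
    (α β : ℝ → ℝ)
    (hα : Melan.IsLowerSolution L a b c p α)
    (hβ : Melan.IsUpperSolution L a b c p β)
    (hα0 : ∀ x ∈ Icc 0 L, 0 ≤ α x ∧ Melan.D L 2 α x ≤ 0)
    (hαβ : ∀ x ∈ Icc 0 L, α x ≤ β x ∧ Melan.D L 2 β x ≤ Melan.D L 2 α x)
    (hβM : a + b * (∫ x in (0 : ℝ)..L, β x) ≤ M)
    (hβN : c - b * sInf (Melan.D L 2 β '' Icc 0 L) ≤ N) :
    -- a solution exists in the sector
    (∃ u ∈ Melan.sector L α β, Melan.IsSolution L a b c p u) ∧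
    -- the iterations started at `α` and `β` exist and are unique as sequences on `[0, L]`
    (∀ y₀, y₀ = α ∨ y₀ = β →
      ∃ y, Melan.IsIteration L a b c M N p y₀ y ∧
        ∀ z, Melan.IsIteration L a b c M N p y₀ z → ∀ n, EqOn (z n) (y n) (Icc 0 L)) ∧
    -- minimal and maximal solutions `ymin`, `ymax` in the sector; the iterations are monotone
    -- and converge uniformly to them
    ∃ ymin ∈ Melan.sector L α β, ∃ ymax ∈ Melan.sector L α β,
      Melan.IsSolution L a b c p ymin ∧ Melan.IsSolution L a b c p ymax ∧
      (∀ u ∈ Melan.sector L α β, Melan.IsSolution L a b c p u →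
        Melan.Precedes L ymin u ∧ Melan.Precedes L u ymax) ∧
      ∀ A B : ℕ → ℝ → ℝ,
        Melan.IsIteration L a b c M N p α A → Melan.IsIteration L a b c M N p β B →
        (∀ n, Melan.Precedes L (A n) (A (n + 1)) ∧ Melan.Precedes L (A n) (B n) ∧
          Melan.Precedes L (B (n + 1)) (B n)) ∧
        TendstoUniformlyOn A ymin atTop (Icc 0 L) ∧
        TendstoUniformlyOn B ymax atTop (Icc 0 L) := by
  obtain ⟨m, hm, rfl⟩ : ∃ m : ℝ, 0 < m ∧ M = m ^ 2 :=
    ⟨√M, Real.sqrt_pos.2 hM, (Real.sq_sqrt hM.le).symm⟩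
  rw [Real.sqrt_sq hm.le] at hMN
  have hA := Melan.admissible_of_le_sigma hL hm hN hMN
  have hβN' : ∀ x ∈ Icc 0 L, c - b * Melan.D L 2 β x ≤ N := by
    intro x hx
    -- `β''` is continuous on a compact interval, so the image is bounded below and `sInf` is not a
    -- default value.
    have hle : sInf (Melan.D L 2 β '' Icc 0 L) ≤ Melan.D L 2 β x :=
      csInf_le (isCompact_Icc.image_of_continuousOn
        (hβ.1.continuousOn hL (by norm_num))).bddBelow (mem_image_of_mem _ hx)
    linarith [mul_le_mul_of_nonneg_left hle hb.le]
  have mono := fun {A B : ℕ → ℝ → ℝ} (iA : Melan.IsIteration L a b c (m ^ 2) N p α A)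
    (iB : Melan.IsIteration L a b c (m ^ 2) N p β B) =>
    Melan.iteration_monotone hL hm hN hA hb hα hβ hαβ hβM hβN' iA iB
  obtain ⟨A, iA⟩ := Melan.exists_isIteration (a := a) (b := b) (c := c) hL hm hN hA hp hα.1
  obtain ⟨B, iB⟩ := Melan.exists_isIteration (a := a) (b := b) (c := c) hL hm hN hA hp hβ.1
  have hAB := mono iA iB
  have loA : ∀ n, Melan.Precedes L α (A n) := by
    intro n
    induction n with
    | zero => rw [iA.1]; exact Melan.Precedes.refl L α
    | succ n ih => exact ih.trans (hAB n).1
  have hiA : ∀ n, Melan.Precedes L (A n) β := fun n => (hAB n).2.1.trans (hAB n).2.2.2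
  have loB : ∀ n, Melan.Precedes L α (B n) := fun n => (loA n).trans (hAB n).2.1
  have hiB : ∀ n, Melan.Precedes L (B n) β := fun n => (hAB n).2.2.2
  obtain ⟨ymin, smin, tmin2, tmin⟩ := iA.exists_limit_of_precedes hL hm hp hα.1 hα.1 hβ.1 loA hiA
    (Or.inl fun n => (hAB n).1)
  obtain ⟨ymax, smax, tmax2, tmax⟩ := iB.exists_limit_of_precedes hL hm hp hβ.1 hα.1 hβ.1 loB hiB
    (Or.inr fun n => (hAB n).2.2.1)
  have secmin : ymin ∈ Melan.sector L α β :=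
    ⟨smin.1.1.of_le (by norm_num), Melan.precedes_of_tendsto_right tmin2 tmin loA,
      Melan.precedes_of_tendsto_left tmin2 tmin hiA⟩
  have secmax : ymax ∈ Melan.sector L α β :=
    ⟨smax.1.1.of_le (by norm_num), Melan.precedes_of_tendsto_right tmax2 tmax loB,
      Melan.precedes_of_tendsto_left tmax2 tmax hiB⟩
  refine ⟨⟨ymin, secmin, smin⟩, ?_, ymin, secmin, ymax, secmax, smin, smax, ?_, ?_⟩
  · rintro y₀ (rfl | rfl)
    · exact ⟨A, iA, fun z hz n => iA.eqOn hL hm hN hA hz n⟩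
    · exact ⟨B, iB, fun z hz n => iB.eqOn hL hm hN hA hz n⟩
  · intro u hu su
    have sstep := su.isStep (N := N) (m ^ 2)
    refine ⟨Melan.precedes_of_tendsto_left tmin2 tmin fun n => ?_,
      Melan.precedes_of_tendsto_right tmax2 tmax fun n => ?_⟩
    -- The step fixes `u`, so its monotonicity carries the comparison with `u` from `A n` to `A (n +
    -- 1)`; `u` precedes `β` by membership in the sector.
    · induction n with
      | zero => rw [iA.1]; exact hu.2.1
      | succ n ih =>
        exact (iA.2 n).precedes hL hm hN hA hb hβ.1 hβM hβN' (iA.memW41 hα.1 n) su.1 ih hu.2.2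
          sstep
    · induction n with
      | zero => rw [iB.1]; exact hu.2.2
      | succ n ih =>
        exact sstep.precedes hL hm hN hA hb hβ.1 hβM hβN' su.1 (iB.memW41 hβ.1 n) ih (hiB n)
          (iB.2 n)
  · intro A' B' iA' iB'
    refine ⟨fun n => ?_, tmin.congr ?_, tmax.congr ?_⟩
    · obtain ⟨h1, h2, h3, -⟩ := mono iA' iB' n
      exact ⟨h1, h2, h3⟩
    · exact Eventually.of_forall fun n => (iA'.eqOn hL hm hN hA iA n)
    · exact Eventually.of_forall fun n => (iB'.eqOn hL hm hN hA iB n)
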